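/- Let $R$ be a commutative noetherian ring. A preradical functor is a subfunctor $\gamma$ of the identity functor of $R\text{-}\mathrm{Mod}$; it is called radical if $\gamma(M/\gamma(M))=0$ for every $R$-module $M$. Let $\mathbb S(R)$ be the set of left exact radical functors, ordered by inclusion of subfunctors. Let $\mathrm{sp}(R)$ be the set of specialization-closed subsets $W\subseteq\mathrm{Spec}(R)$ (that is, $\mathfrak p\in W$ and $\mathfrak p\subseteq\mathfrak q$ imply $\mathfrak q\in W$), ordered by inclusion. For $W \in \mathrm{sp}(R)$ let $\varGamma_W(M)=\{x\in M\mid \mathrm{Supp}(Rx)\subseteq W\}$. A triangle functor $\delta:\mathcal D^+(R\text{-}\mathrm{Mod})\to\mathcal D^+(R\text{-}\mathrm{Mod})$ is called an abstract local cohomology functor if (1) the inclusion $i$ of its essential image $\mathrm{Im}(\delta)$ (regarded as a full subcategory) into $\mathcal D^+(R\text{-}\mathrm{Mod})$ has a right adjoint $\rho$ with $\delta\cong i\circ\rho$, and (2) every indecomposable injective $R$-module, regarded as a complex in degree $0$, belongs to $\mathrm{Im}(\delta)$ or to $\mathrm{Ker}(\delta)=\{X\mid\delta(X)\cong 0\}$.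 Let $\mathbb A(R)$ be the set of isomorphism classes $[\delta]$ of abstract local cohomology functors, and for $a,b\in\mathbb A(R)$ put $a\subseteq b$ if there are $\gamma_1,\gamma_2\in\mathbb S(R)$ with $a=[\mathbf R\gamma_1]$, $b=[\mathbf R\gamma_2]$ and $\gamma_1\subseteq\gamma_2$. Then $\mathrm{sp}(R)$, $\mathbb S(R)$ and $\mathbb A(R)$ are complete lattices (partially ordered sets in which every subset has a least upper bound and a greatest lower bound), and the maps $$\mathrm{sp}(R)\to\mathbb S(R),\ W\mapsto\varGamma_W;\qquad \mathbb S(R)\to\mathbb A(R),\ \gamma\mapsto[\mathbf R\gamma];\qquad \mathrm{sp}(R)\to\mathbb A(R),\ W\mapsto[\mathbf R\varGamma_W]$$ are well defined, bijective, and isomorphisms of complete lattices. -/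

import Mathlib

open CategoryTheory CategoryTheory.Limits

universe w u

/-- A preradical functor on `R`-modules, i.e. a subfunctor of the identity functor: a submodule
`γ M ⊆ M` for every module `M`, such that every linear map `f : M → N` restricts to
`γ M → γ N`. -/
@[ext]
structure PreradicalFunctor (R : Type u) [CommRing R] where
  /-- The submodule `γ M` of `M`. -/
  obj (M : ModuleCat.{u} R) : Submodule R M
  map_le {M N : ModuleCat.{u} R} (f : M ⟶ N) : obj M ≤ (obj N).comap f.hom

namespace PreradicalFunctor

variable {R : Type u} [CommRing R]

/-- The order `γ₁ ⊆ γ₂` given by inclusion of subfunctors (the condition on morphisms is automatic,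
as both act by restriction). -/
instance : PartialOrder (PreradicalFunctor R) :=
  PartialOrder.lift PreradicalFunctor.obj (fun _ _ h ↦ PreradicalFunctor.ext h)

/-- The functor `M ↦ γ M`, `f ↦ f|_{γ M}` underlying a preradical functor. -/
def toFunctor (γ : PreradicalFunctor R) : ModuleCat.{u} R ⥤ ModuleCat.{u} R where
  obj M := ModuleCat.of R (γ.obj M)
  map f := ModuleCat.ofHom (f.hom.restrict (γ.map_le f))

instance (γ : PreradicalFunctor R) : γ.toFunctor.Additive where

/-- A preradical functor is left exact if its underlying functor is. -/
def IsLeftExact (γ : PreradicalFunctor R) : Prop :=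
  PreservesFiniteLimits γ.toFunctor

/-- A preradical functor `γ` is radical if `γ (M / γ M) = 0` for every module `M`. -/
def IsRadical (γ : PreradicalFunctor R) : Prop :=
  ∀ M : ModuleCat.{u} R, γ.obj (ModuleCat.of R (M ⧸ γ.obj M)) = ⊥

end PreradicalFunctor

/-- The set `𝕊(R)` of left exact radical functors, ordered by inclusion of subfunctors. -/
abbrev LeftExactRadical (R : Type u) [CommRing R] : Type (u + 1) :=
  {γ : PreradicalFunctor R // γ.IsLeftExact ∧ γ.IsRadical}

/-- The set `sp(R)` of specialization-closed subsets of `Spec R` (those `W` such that `𝔭 ∈ W` and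
`𝔭 ⊆ 𝔮` imply `𝔮 ∈ W`), ordered by inclusion, with unions and intersections as suprema and
infima. -/
def SpecializationClosed (R : Type u) [CommRing R] :
    CompleteSublattice (Set (PrimeSpectrum R)) :=
  CompleteSublattice.mk' {W | IsUpperSet W}
    (fun _ h ↦ isUpperSet_sUnion fun _ hs ↦ h hs)
    (fun _ h ↦ isUpperSet_sInter fun _ hs ↦ h hs)

/-- The section functor `Γ_W` with support in `W`:
`Γ_W(M) = {x ∈ M | Supp(Rx) ⊆ W}`. -/
def sectionFunctor {R : Type u} [CommRing R] (W : Set (PrimeSpectrum R)) :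
    PreradicalFunctor R where
  obj M :=
    { carrier := {x | Module.support R (Submodule.span R {x}) ⊆ W}
      add_mem' := by
        intro x y hx hy p hp
        rw [Module.mem_support_iff_of_finite] at hp
        by_contra hpW
        have key : ∀ z : M, Module.support R (Submodule.span R {z}) ⊆ W →
            ∃ r, r ∉ p.asIdeal ∧ r • z = 0 := by
          intro z hz
          have h : p ∉ Module.support R (Submodule.span R {z}) := fun h ↦ hpW (hz h)
          rw [Module.mem_support_iff_of_finite] at h
          obtain ⟨r, hr, hrp⟩ := Set.not_subset.mp h
          exact ⟨r, hrp, (Submodule.mem_annihilator_span_singleton _ _).mp hr⟩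
        obtain ⟨r, hr, hrx⟩ := key x hx
        obtain ⟨s, hs, hsy⟩ := key y hy
        have hrs : r * s ∈ (Submodule.span R {x + y}).annihilator := by
          rw [Submodule.mem_annihilator_span_singleton, smul_add, mul_comm r s, mul_smul, hrx,
            mul_comm s r, mul_smul, hsy, smul_zero, smul_zero, add_zero]
        exact (p.2.mem_or_mem (hp hrs)).elim hr hs
      zero_mem' := by
        have : Subsingleton (Submodule.span R {(0 : M)}) := by
          rw [Submodule.span_zero_singleton]; infer_instance
        simp only [Set.mem_ofPred_eq, Module.support_eq_empty, Set.empty_subset]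
      smul_mem' := by
        intro c x hx
        exact (Module.support_subset_of_injective
          (Submodule.inclusion (Submodule.span_singleton_smul_le R c x))
          (Submodule.inclusion_injective _)).trans hx }
  map_le := by
    intro M N f x hx
    have h : Submodule.span R {f.hom x} = (Submodule.span R {x}).map f.hom := by
      rw [Submodule.map_span, Set.image_singleton]
    change Module.support R (Submodule.span R {f.hom x}) ⊆ W
    rw [h]
    exact (Module.support_subset_of_surjective _
      (f.hom.submoduleMap_surjective (Submodule.span R {x}))).trans hx

section Derived

variable {R : Type u} [CommRing R] [HasDerivedCategory.{w} (ModuleCat.{u} R)]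

/-- An endofunctor `δ` of `D⁺(R-Mod)` is an abstract local cohomology functor if it is a triangle
functor, the inclusion `i : Im δ → D⁺(R-Mod)` of its essential image has a right adjoint `ρ` with
`δ ≅ i ∘ ρ`, and each indecomposable injective module, as a complex in degree `0`, belongs to
`Im δ` or to `Ker δ`. -/
structure IsAbstractLocalCohomology
    (δ : DerivedCategory.Plus (ModuleCat.{u} R) ⥤ DerivedCategory.Plus (ModuleCat.{u} R)) :
    Prop where
  isTriangleFunctor : ∃ _ : δ.CommShift ℤ, δ.IsTriangulated
  exists_rightAdjoint :
    ∃ ρ : DerivedCategory.Plus (ModuleCat.{u} R) ⥤ δ.essImage.FullSubcategory,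
      Nonempty (δ.essImage.ι ⊣ ρ) ∧ Nonempty (δ ≅ ρ ⋙ δ.essImage.ι)
  divides (E : ModuleCat.{u} R) (hE : Injective E) (hE' : Indecomposable E) :
    δ.essImage ((DerivedCategory.Plus.singleFunctor (ModuleCat.{u} R) 0).obj E) ∨
      δ.kernel ((DerivedCategory.Plus.singleFunctor (ModuleCat.{u} R) 0).obj E)

variable (R) in
/-- Isomorphism classes of endofunctors of `D⁺(R-Mod)`. -/
abbrev EndofunctorClass : Type _ :=
  Quotient (isIsomorphicSetoid
    (DerivedCategory.Plus (ModuleCat.{u} R) ⥤ DerivedCategory.Plus (ModuleCat.{u} R)))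

/-- The isomorphism class `[𝐑γ]` of the right derived functor of a preradical functor `γ`. -/
noncomputable def derivedClass (γ : PreradicalFunctor R) : EndofunctorClass R :=
  Quotient.mk _ γ.toFunctor.rightDerivedFunctorPlus

variable (R) in
/-- The set `𝔸(R)` of isomorphism classes of abstract local cohomology functors. -/
def AbstractLocalCohomologyClass : Type _ :=
  {c : EndofunctorClass R // ∃ δ, IsAbstractLocalCohomology δ ∧ Quotient.mk _ δ = c}

/-- The order on `𝔸(R)`: `[𝐑γ₁] ⊆ [𝐑γ₂]` when `γ₁ ⊆ γ₂`, for `γ₁` and `γ₂` in `𝕊(R)`. -/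
instance : LE (AbstractLocalCohomologyClass R) where
  le a b := ∃ γ₁ γ₂ : LeftExactRadical R,
    a.1 = derivedClass γ₁.1 ∧ b.1 = derivedClass γ₂.1 ∧ γ₁ ≤ γ₂

end Derived

/-- The relation `≤` on `α` is a partial order for which every subset has a least upper bound and
a greatest lower bound. -/
structure IsCompleteLatticeOrder (α : Type*) [LE α] : Prop where
  le_refl (a : α) : a ≤ a
  le_trans (a b c : α) : a ≤ b → b ≤ c → a ≤ c
  le_antisymm (a b : α) : a ≤ b → b ≤ a → a = b
  exists_isLUB (s : Set α) : ∃ a, IsLUB s a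
  exists_isGLB (s : Set α) : ∃ a, IsGLB s a

/-! A left exact radical functor γ is determined by the primes p with γ(R/p) = R/p. Left exactness
reduces membership to cyclic submodules, and radicality makes the modules fixed by γ closed under
extensions, so a prime filtration shows that γ fixes every finitely generated module which is
torsion for these primes (`PreradicalFunctor.eq_sectionFunctor_primes`).

On the derived side, 𝐑Γ_W is the coreflection of D⁺ onto the objects with W-torsion homology. This
rests on two facts: Γ_W preserves injectives, by Artin-Rees (`sectionFunctor_injective`), and a
bounded below complex of torsion-free injectives with torsion homology is acyclic
(`acyclic_of_torsionFree`). The essential image of 𝐑Γ_W recovers W, so distinct W give distinct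
classes.

Conversely, let δ be an abstract local cohomology functor and W the set of primes of the
indecomposable injectives in Im δ. Then Im δ is the left orthogonal of Ker δ. Maps to injectives in
Ker δ show that objects of Im δ have W-torsion homology, and W-torsion injectives lie in Im δ. For
equality, a torsion object C of Ker δ must vanish. Peeling off injectives gives maps X_k → C with
cone in Im δ and X_k in degrees ≥ a + k. All X_k[k] are retracts of one bounded below object, so δ
X_k lives in degrees ≥ b + k with b independent of k (`isZero_homology_obj`), and large k kills each
homology module of C. Finally, a coreflection is determined by its essential image, so δ ≅ 𝐑Γ_W. -/

/-! ### Elementwise torsion with respect to a set of primes. -/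

section Torsion

variable {R : Type*} [CommRing R]

/-- An element `x` of an `R`-module is `W`-torsion if it vanishes in the localization at each
prime outside `W`. -/
def IsTors (W : Set (PrimeSpectrum R)) {M : Type*} [AddCommGroup M] [Module R M] (x : M) : Prop :=
  ∀ p ∉ W, ∃ r ∉ p.asIdeal, r • x = 0

variable {W : Set (PrimeSpectrum R)} {M N P : Type*} [AddCommGroup M] [Module R M]
  [AddCommGroup N] [Module R N] [AddCommGroup P] [Module R P]

lemma isTors_iff_support {x : M} :
    IsTors W x ↔ Module.support R (Submodule.span R {x}) ⊆ W := by
  constructor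
  · intro h p hp
    rw [Module.mem_support_iff_of_finite] at hp
    by_contra hpW
    obtain ⟨r, hr, hrx⟩ := h p hpW
    exact hr (hp ((Submodule.mem_annihilator_span_singleton _ _).mpr hrx))
  · intro h p hp
    have h : p ∉ Module.support R (Submodule.span R {x}) := fun h' ↦ hp (h h')
    rw [Module.mem_support_iff_of_finite] at h
    obtain ⟨r, hr, hrp⟩ := Set.not_subset.mp h
    exact ⟨r, hrp, (Submodule.mem_annihilator_span_singleton _ _).mp hr⟩

lemma IsTors.map {x : M} (h : IsTors W x) (f : M →ₗ[R] N) : IsTors W (f x) := fun p hp ↦ by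
  obtain ⟨r, hr, hx⟩ := h p hp
  exact ⟨r, hr, by rw [← map_smul, hx, map_zero]⟩

lemma IsTors.of_map {x : M} (f : M →ₗ[R] N) (hf : Function.Injective f) (h : IsTors W (f x)) :
    IsTors W x := fun p hp ↦ by
  obtain ⟨r, hr, hx⟩ := h p hp
  exact ⟨r, hr, hf (by rw [map_smul, hx, map_zero])⟩

lemma IsTors.mono {W' : Set (PrimeSpectrum R)} (hW : W ⊆ W') {x : M} (h : IsTors W x) :
    IsTors W' x := fun p hp ↦ h p (fun hp' ↦ hp (hW hp'))

lemma isTors_zero : IsTors W (0 : M) := fun p _ ↦ ⟨1, p.2.one_notMem, by simp⟩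

/-- Multipliers outside p compose because p is prime. This is the source of radicality and of
closure under extensions. -/
lemma IsTors.of_smul {x : M} (h : ∀ p ∉ W, ∃ r ∉ p.asIdeal, IsTors W (r • x)) : IsTors W x := by
  intro p hp
  obtain ⟨r, hr, hx⟩ := h p hp
  obtain ⟨s, hs, hsx⟩ := hx p hp
  exact ⟨s * r, fun h ↦ (p.2.mem_or_mem h).elim hs hr, by rw [mul_smul, hsx]⟩

lemma IsTors.smul {x : M} (h : IsTors W x) (r : R) : IsTors W (r • x) :=
  h.map (LinearMap.lsmul R M r)

lemma isTors_of_exact {f : M →ₗ[R] N} {g : N →ₗ[R] P} (hfg : Function.Exact f g)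
    (hM : ∀ x : M, IsTors W x) (hP : ∀ x : P, IsTors W x) (x : N) : IsTors W x := by
  refine .of_smul fun p hp ↦ ?_
  obtain ⟨r, hr, hx⟩ := hP (g x) p hp
  obtain ⟨y, hy⟩ := (hfg (r • x)).1 (by rw [map_smul, hx])
  exact ⟨r, hr, hy ▸ (hM y).map f⟩

lemma isTors_quotient_iff {W : Set (PrimeSpectrum R)} (hW : IsUpperSet W) (p : PrimeSpectrum R) :
    (∀ x : R ⧸ p.asIdeal, IsTors W x) ↔ p ∈ W := by
  constructor
  · intro h
    by_contra hp
    obtain ⟨r, hr, h⟩ := h (Submodule.Quotient.mk 1) p hp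
    rw [← Submodule.Quotient.mk_smul, Submodule.Quotient.mk_eq_zero] at h
    exact hr (by simpa using h)
  · intro hp x q hq
    have : ¬ p.asIdeal ≤ q.asIdeal := fun h ↦ hq (hW h hp)
    obtain ⟨r, hr, hrq⟩ := Set.not_subset.mp this
    refine ⟨r, hrq, ?_⟩
    obtain ⟨y, rfl⟩ := Submodule.Quotient.mk_surjective _ x
    rw [← Submodule.Quotient.mk_smul, Submodule.Quotient.mk_eq_zero]
    exact Ideal.mul_mem_right _ _ hr

/-- A finitely generated torsion module is annihilated by an ideal not contained in any prime
outside `W`. -/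
lemma exists_smul_eq_zero_of_fg {K : Submodule R M} (hK : K.FG)
    (h : ∀ x ∈ K, IsTors W x) (p : PrimeSpectrum R) (hp : p ∉ W) :
    ∃ r ∉ p.asIdeal, ∀ x ∈ K, r • x = 0 := by
  obtain ⟨S, rfl⟩ := hK
  have (x : S) : ∃ r ∉ p.asIdeal, r • x.1 = 0 := h x.1 (Submodule.subset_span x.2) p hp
  choose r hr hrx using this
  refine ⟨∏ x, r x, ?_, ?_⟩
  · intro hmem
    obtain ⟨x, -, hx⟩ := (p.2.prod_mem_iff (s := Finset.univ)).1 hmem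
    exact hr x hx
  · intro x hx
    induction hx using Submodule.span_induction with
    | mem x hx =>
      have : r ⟨x, hx⟩ ∣ ∏ x, r x := Finset.dvd_prod_of_mem _ (Finset.mem_univ _)
      obtain ⟨c, hc⟩ := this
      rw [hc, mul_comm, mul_smul, hrx ⟨x, hx⟩, smul_zero]
    | zero => simp
    | add x y _ _ hx hy => rw [smul_add, hx, hy, add_zero]
    | smul a x _ hx => rw [smul_comm, hx, smul_zero]

end Torsion

/-! ### Section functors are left exact and radical. -/

section SectionFunctor

variable {R : Type u} [CommRing R] {W : Set (PrimeSpectrum R)}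

lemma mem_sectionFunctor_iff {M : ModuleCat.{u} R} (x : M) :
    x ∈ (sectionFunctor W).obj M ↔ IsTors W x :=
  isTors_iff_support.symm

namespace PreradicalFunctor

/-- The inclusion of the functor underlying a preradical functor into the identity functor. -/
def incl (γ : PreradicalFunctor R) : γ.toFunctor ⟶ 𝟭 (ModuleCat.{u} R) where
  app M := ModuleCat.ofHom (γ.obj M).subtype

instance (γ : PreradicalFunctor R) (M : ModuleCat.{u} R) : Mono (γ.incl.app M) :=
  (ModuleCat.mono_iff_injective _).2 (γ.obj M).subtype_injective

instance (γ : PreradicalFunctor R) {M N : ModuleCat.{u} R} (f : M ⟶ N) [Mono f] :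
    Mono (γ.toFunctor.map f) := by
  have : Mono (γ.toFunctor.map f ≫ γ.incl.app N) := by
    rw [γ.incl.naturality]
    exact mono_comp _ _
  exact mono_of_mono _ (γ.incl.app N)

/-- Monomorphisms are preserved in any case, so left exactness amounts to γ M = M ∩ γ N for
submodules M of N. -/
lemma isLeftExact_iff (γ : PreradicalFunctor R) :
    γ.IsLeftExact ↔ ∀ {M N : ModuleCat.{u} R} (f : M ⟶ N) [Mono f] (x : M),
      f.hom x ∈ γ.obj N → x ∈ γ.obj M := by
  refine (Functor.preservesFiniteLimits_iff_forall_exact_map_and_mono γ.toFunctor).trans ⟨?_, ?_⟩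
  · intro h M N f _ x hx
    have hS : (ShortComplex.mk f (cokernel.π f) (by simp)).ShortExact :=
      { exact := ShortComplex.exact_cokernel f }
    have := (ShortComplex.ShortExact.moduleCat_exact_iff_function_exact _).1 (h _ hS).1
    obtain ⟨y, hy⟩ := (this ⟨f.hom x, hx⟩).1 (Subtype.ext (by
      change (f ≫ cokernel.π f).hom x = 0
      simp))
    have hy : f.hom y.1 = f.hom x := congr_arg Subtype.val hy
    rw [← (ModuleCat.mono_iff_injective f).1 inferInstance hy]
    exact y.2
  · intro h S hS
    have := hS.mono_f
    refine ⟨?_, inferInstanceAs (Mono (γ.toFunctor.map S.f))⟩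
    rw [ShortComplex.ShortExact.moduleCat_exact_iff_function_exact]
    have hS' := (ShortComplex.ShortExact.moduleCat_exact_iff_function_exact _).1 hS.exact
    rintro ⟨x, hx⟩
    constructor
    · intro hx'
      obtain ⟨y, rfl⟩ := (hS' x).1 (congr_arg Subtype.val hx')
      exact ⟨⟨y, h S.f y hx⟩, rfl⟩
    · rintro ⟨y, hy⟩
      refine Subtype.ext ?_
      have : S.f.hom y.1 = x := congr_arg Subtype.val hy
      exact (hS' x).2 ⟨_, this⟩

end PreradicalFunctor

lemma sectionFunctor_isLeftExact (W : Set (PrimeSpectrum R)) :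
    (sectionFunctor W).IsLeftExact := by
  rw [PreradicalFunctor.isLeftExact_iff]
  intro M N f _ x hx
  rw [mem_sectionFunctor_iff] at hx ⊢
  exact hx.of_map f.hom ((ModuleCat.mono_iff_injective f).1 inferInstance)

lemma sectionFunctor_isRadical (W : Set (PrimeSpectrum R)) :
    (sectionFunctor W).IsRadical := by
  intro M
  rw [eq_bot_iff]
  intro x hx
  rw [mem_sectionFunctor_iff] at hx
  obtain ⟨y, rfl⟩ := Submodule.Quotient.mk_surjective _ x
  rw [Submodule.mem_bot, Submodule.Quotient.mk_eq_zero, mem_sectionFunctor_iff]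
  refine .of_smul fun p hp ↦ ?_
  obtain ⟨r, hr, hx⟩ := hx p hp
  exact ⟨r, hr, (mem_sectionFunctor_iff _).1 ((Submodule.Quotient.mk_eq_zero _).1 hx)⟩

end SectionFunctor

/-! ### Left exact radical functors are section functors. -/

section Classification

variable {R : Type u} [CommRing R]

namespace PreradicalFunctor

variable (γ : PreradicalFunctor R)

lemma map_mem {M N : Type u} [AddCommGroup M] [Module R M] [AddCommGroup N] [Module R N]
    (f : M →ₗ[R] N) {x : M} (hx : x ∈ γ.obj (ModuleCat.of R M)) :
    f x ∈ γ.obj (ModuleCat.of R N) :=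
  γ.map_le (ModuleCat.ofHom f) hx

lemma obj_eq_top_of_surjective {M N : Type u} [AddCommGroup M] [Module R M] [AddCommGroup N]
    [Module R N] (f : M →ₗ[R] N) (hf : Function.Surjective f)
    (h : γ.obj (ModuleCat.of R M) = ⊤) : γ.obj (ModuleCat.of R N) = ⊤ := by
  rw [eq_top_iff]
  intro y _
  obtain ⟨x, rfl⟩ := hf y
  exact γ.map_mem f (h ▸ Submodule.mem_top)

variable {γ}

/-- The projection N → N / γ N kills the image of M = γ M, so it factors through P = γ P and lands
in γ (N / γ N) = 0. -/
lemma IsRadical.obj_eq_top_of_exact (hγ : γ.IsRadical) {M N P : Type u} [AddCommGroup M]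
    [Module R M] [AddCommGroup N] [Module R N] [AddCommGroup P] [Module R P]
    {f : M →ₗ[R] N} {g : N →ₗ[R] P} (hfg : Function.Exact f g) (hg : Function.Surjective g)
    (hM : γ.obj (ModuleCat.of R M) = ⊤) (hP : γ.obj (ModuleCat.of R P) = ⊤) :
    γ.obj (ModuleCat.of R N) = ⊤ := by
  have hle : LinearMap.ker g ≤ LinearMap.ker (γ.obj (ModuleCat.of R N)).mkQ := by
    intro y hy
    obtain ⟨x, rfl⟩ := (hfg y).1 hy
    rw [Submodule.ker_mkQ]
    exact γ.map_mem f (hM ▸ Submodule.mem_top)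
  let h : P →ₗ[R] (N ⧸ γ.obj (ModuleCat.of R N)) :=
    (LinearMap.ker g).liftQ _ hle ∘ₗ (g.quotKerEquivOfSurjective hg).symm.toLinearMap
  have hh (y : N) : h (g y) = Submodule.Quotient.mk y := by
    have : (g.quotKerEquivOfSurjective hg).symm (g y) = Submodule.Quotient.mk y := by
      rw [LinearEquiv.symm_apply_eq]; rfl
    simp [h, this]
  rw [eq_top_iff]
  intro y _
  have := γ.map_mem h (x := g y) (hP ▸ Submodule.mem_top)
  rw [hh] at this
  have h2 := hγ (ModuleCat.of R N) ▸ this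
  exact (Submodule.Quotient.mk_eq_zero _).1 h2

lemma IsLeftExact.mem_iff_obj_span_eq_top (hγ : γ.IsLeftExact) {M : ModuleCat.{u} R} (x : M) :
    x ∈ γ.obj M ↔ γ.obj (ModuleCat.of R (Submodule.span R {x})) = ⊤ := by
  constructor
  · intro hx
    rw [eq_top_iff]
    rintro ⟨y, hy⟩ _
    have : Mono (ModuleCat.ofHom (Submodule.span R {x}).subtype) :=
      (ModuleCat.mono_iff_injective _).2 (Submodule.subtype_injective _)
    refine (isLeftExact_iff γ).1 hγ (ModuleCat.ofHom (Submodule.span R {x}).subtype) ⟨y, hy⟩ ?_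
    exact (Submodule.span_singleton_le_iff_mem _ _).2 hx hy
  · intro h
    exact γ.map_mem (Submodule.span R {x}).subtype
      (x := ⟨x, Submodule.mem_span_singleton_self x⟩) (h ▸ Submodule.mem_top)

variable (γ) in
/-- The primes `p` such that `R ⧸ p` is fixed by the preradical functor `γ`. -/
def primes : Set (PrimeSpectrum R) :=
  {p | γ.obj (ModuleCat.of R (R ⧸ p.asIdeal)) = ⊤}

variable (γ) in
lemma isUpperSet_primes : IsUpperSet γ.primes := fun p q hpq hp ↦
  γ.obj_eq_top_of_surjective (Submodule.factor (p := p.asIdeal) (p' := q.asIdeal) hpq)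
    (Submodule.factor_surjective hpq) hp

/-- Induction along a prime filtration: a torsion factor R/p has p in `γ.primes`, and extensions are
handled by radicality. -/
lemma IsRadical.obj_eq_top_of_isTors [IsNoetherianRing R] (hγ : γ.IsRadical) (M : Type u)
    [AddCommGroup M] [Module R M] [Module.Finite R M] (hM : ∀ x : M, IsTors γ.primes x) :
    γ.obj (ModuleCat.of R M) = ⊤ := by
  refine IsNoetherianRing.induction_on_isQuotientEquivQuotientPrime R (M := M) inferInstance
    (motive := fun N _ _ _ ↦ (∀ x : N, IsTors γ.primes x) → γ.obj (ModuleCat.of R N) = ⊤)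
    ?_ ?_ ?_ hM
  · intro N _ _ _ _ _
    rw [eq_top_iff]
    intro x _
    have : x = 0 := Subsingleton.elim (α := N) _ _
    exact this ▸ Submodule.zero_mem _
  · intro N _ _ _ p e h
    refine γ.obj_eq_top_of_surjective e.symm.toLinearMap e.symm.surjective ?_
    refine (isTors_quotient_iff γ.isUpperSet_primes p).1 fun x ↦ ?_
    have := (h (e.symm x)).map e.toLinearMap
    simpa using this
  · intro N₁ _ _ _ N₂ _ _ _ N₃ _ _ _ f g hf hg hfg h₁ h₃ h
    refine hγ.obj_eq_top_of_exact hfg hg (h₁ fun x ↦ (h (f x)).of_map f hf) (h₃ fun x ↦ ?_)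
    obtain ⟨y, rfl⟩ := hg x
    exact (h y).map g

/-- If x lies in γ M, then γ fixes Rx and hence its quotient R/p for each prime p containing the
annihilator of x. Conversely, Rx is finitely generated and torsion, so γ fixes it. -/
lemma eq_sectionFunctor_primes [IsNoetherianRing R] (h₁ : γ.IsLeftExact) (h₂ : γ.IsRadical) :
    γ = sectionFunctor γ.primes := by
  ext M x
  rw [mem_sectionFunctor_iff]
  constructor
  · intro hx p hp
    by_contra! h
    apply hp
    have hle : Ideal.torsionOf R M x ≤ p.asIdeal := by
      intro r hr
      by_contra hrp
      exact h r hrp ((Ideal.mem_torsionOf_iff x r).1 hr)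
    refine γ.obj_eq_top_of_surjective (Submodule.factor hle ∘ₗ
      (Ideal.quotTorsionOfEquivSpanSingleton R M x).symm.toLinearMap) ?_
      ((h₁.mem_iff_obj_span_eq_top x).1 hx)
    exact (Submodule.factor_surjective hle).comp (LinearEquiv.surjective _)
  · intro hx
    rw [h₁.mem_iff_obj_span_eq_top]
    refine h₂.obj_eq_top_of_isTors _ ?_
    rintro ⟨y, hy⟩
    refine .of_map (Submodule.span R {x}).subtype (Submodule.subtype_injective _) ?_
    obtain ⟨r, rfl⟩ := Submodule.mem_span_singleton.1 hy
    exact hx.smul r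

end PreradicalFunctor

lemma primes_sectionFunctor {W : Set (PrimeSpectrum R)} (hW : IsUpperSet W) :
    (sectionFunctor W).primes = W := by
  ext p
  rw [← isTors_quotient_iff hW]
  simp only [PreradicalFunctor.primes, Set.mem_ofPred_eq, eq_top_iff, SetLike.le_def,
    Submodule.mem_top, true_imp_iff]
  exact forall_congr' fun x ↦ mem_sectionFunctor_iff (M := ModuleCat.of R (R ⧸ p.asIdeal)) x

lemma sectionFunctor_le_iff {W W' : Set (PrimeSpectrum R)} (hW : IsUpperSet W)
    (hW' : IsUpperSet W') : sectionFunctor W ≤ sectionFunctor W' ↔ W ⊆ W' := by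
  constructor
  · intro h p hp
    rw [← primes_sectionFunctor hW] at hp
    rw [← primes_sectionFunctor hW']
    exact top_le_iff.1 (le_of_eq_of_le (Eq.symm hp) (h _))
  · intro h M x hx
    rw [mem_sectionFunctor_iff] at hx ⊢
    exact hx.mono h

end Classification

/-! ### Section functors preserve injective modules. -/

section Injective

variable {R : Type u} [CommRing R]

lemma ModuleCat.injective_iff_baer (M : ModuleCat.{u} R) : Injective M ↔ Module.Baer R M := by
  rw [Module.Baer.iff_injective, Module.injective_iff_injective_object]

variable [IsNoetherianRing R]

/-- The section functor preserves injectives over a noetherian ring, by the Artin-Rees lemma. -/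
lemma sectionFunctor_injective (W : Set (PrimeSpectrum R)) (E : ModuleCat.{u} R)
    [hE : Injective E] :
    Injective ((sectionFunctor W).toFunctor.obj E) := by
  have hE := (ModuleCat.injective_iff_baer E).1 hE
  refine (ModuleCat.injective_iff_baer _).2 fun I g ↦ ?_
  change I →ₗ[R] (sectionFunctor W).obj E at g
  let J : Ideal R := (LinearMap.range g).annihilator
  obtain ⟨k, hk⟩ := Ideal.exists_pow_inf_eq_pow_smul J (M := R) I
  -- The exponent k + 1 leaves one factor J in front. Since J annihilates the range of g, the map g
  -- then factors through the image of I in R / J^(k+1).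
  have hk : J ^ (k + 1) ⊓ I ≤ J • I := by
    have := hk (k + 1) (by lia)
    simp only [smul_eq_mul, Ideal.mul_top, add_tsub_cancel_left, pow_one] at this
    rw [this]
    exact Ideal.mul_mono_right inf_le_right
  let φ : I →ₗ[R] R ⧸ J ^ (k + 1) := (J ^ (k + 1)).mkQ ∘ₗ I.subtype
  have hφ : LinearMap.ker φ ≤ LinearMap.ker ((Submodule.subtype _) ∘ₗ g) := by
    rintro ⟨x, hx⟩ hxJ
    have : (J ^ (k + 1)).mkQ x = 0 := hxJ
    rw [Submodule.mkQ_apply, Submodule.Quotient.mk_eq_zero] at this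
    have hx' := hk ⟨this, hx⟩
    have key : J • I ≤ (LinearMap.ker g).map I.subtype := by
      refine Submodule.smul_le.2 fun a ha b hb ↦ ⟨a • ⟨b, hb⟩, ?_, rfl⟩
      rw [SetLike.mem_coe, LinearMap.mem_ker, map_smul]
      exact Submodule.mem_annihilator.1 ha _ ⟨_, rfl⟩
    obtain ⟨y, hy, rfl⟩ := key hx'
    rw [SetLike.mem_coe, LinearMap.mem_ker] at hy
    simp [hy]
  obtain ⟨h, hh⟩ := hE.extension_property ((LinearMap.ker φ).liftQ φ le_rfl)
    (LinearMap.ker_eq_bot.1 (Submodule.ker_liftQ_eq_bot _ _ _ le_rfl))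
    ((LinearMap.ker φ).liftQ _ hφ)
  have hh' (x : I) : h (φ x) = (g x).1 := LinearMap.congr_fun hh (Submodule.Quotient.mk x)
  -- The extension to R / J^(k+1) has image killed by J^(k+1), and J is contained in no prime
  -- outside W, so the image is torsion.
  have hmem : ∀ r : R, h ((J ^ (k + 1)).mkQ r) ∈ (sectionFunctor W).obj E := by
    intro r
    rw [mem_sectionFunctor_iff]
    intro p hp
    obtain ⟨s, hs, hsg⟩ := exists_smul_eq_zero_of_fg (K := LinearMap.range g)
      (IsNoetherian.noetherian (R := R) (M := I) ⊤ |>.map g |> fun h ↦ by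
        rwa [Submodule.map_top] at h)
      (W := W) (by
        rintro _ ⟨x, rfl⟩
        exact .of_map _ (Submodule.subtype_injective _) ((mem_sectionFunctor_iff _).1 (g x).2)) p hp
    have hsJ : s ∈ J := Submodule.mem_annihilator.2 hsg
    refine ⟨s ^ (k + 1), fun h ↦ hs (p.2.mem_of_pow_mem _ h), ?_⟩
    rw [← map_smul, ← map_smul]
    convert map_zero h
    rw [Submodule.mkQ_apply, Submodule.Quotient.mk_eq_zero]
    exact Ideal.mul_mem_right _ _ (Ideal.pow_mem_pow hsJ _)
  exact ⟨LinearMap.codRestrict _ (h ∘ₗ (J ^ (k + 1)).mkQ) hmem, fun x hx ↦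
    Subtype.ext (hh' ⟨x, hx⟩)⟩

end Injective

/-! ### Indecomposable injectives over a noetherian ring. -/

section Hull

variable {R : Type u} [CommRing R]

lemma Module.Baer.of_retract {M N : Type*} [AddCommGroup M] [Module R M] [AddCommGroup N]
    [Module R N] (i : M →ₗ[R] N) (r : N →ₗ[R] M) (h : r ∘ₗ i = LinearMap.id)
    (hN : Module.Baer R N) : Module.Baer R M := fun I g ↦ by
  obtain ⟨g', hg'⟩ := hN I (i ∘ₗ g)
  refine ⟨r ∘ₗ g', fun x hx ↦ ?_⟩
  rw [LinearMap.comp_apply, hg' x hx]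
  exact LinearMap.congr_fun h _

/-- The kernel of a split surjection from an injective module is injective. -/
lemma Module.Baer.ker {M N : Type*} [AddCommGroup M] [Module R M] [AddCommGroup N]
    [Module R N] (q : M →ₗ[R] N) (s : N →ₗ[R] M) (h : q ∘ₗ s = LinearMap.id)
    (hM : Module.Baer R M) : Module.Baer R (LinearMap.ker q) := by
  have hs (x : N) : q (s x) = x := LinearMap.congr_fun h x
  refine hM.of_retract (LinearMap.ker q).subtype
    (LinearMap.codRestrict _ (LinearMap.id - s ∘ₗ q) fun x ↦ by simp [hs]) ?_
  ext x
  have : q x = 0 := x.2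
  simp [this]

/-- Over a noetherian ring, a directed union of injective submodules is injective. -/
lemma Module.Baer.sSup_of_directedOn [IsNoetherianRing R] {M : Type*} [AddCommGroup M] [Module R M]
    {c : Set (Submodule R M)} (hc : c.Nonempty) (hd : DirectedOn (· ≤ ·) c)
    (h : ∀ K ∈ c, Module.Baer R K) : Module.Baer R (sSup c : Submodule R M) := by
  intro I g
  have hfg : (LinearMap.range ((sSup c).subtype ∘ₗ g)).FG := by
    rw [LinearMap.range_eq_map]
    exact (IsNoetherian.noetherian _).map _
  obtain ⟨K, hK, hle⟩ := (CompleteLattice.isCompactElement_iff_le_of_directed_sSup_le _ _).1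
    ((Submodule.fg_iff_compact _).1 hfg) c hc hd (by
      rintro _ ⟨x, rfl⟩
      exact (g x).2)
  obtain ⟨g', hg'⟩ := h K hK I (LinearMap.codRestrict K ((sSup c).subtype ∘ₗ g)
    fun x ↦ hle ⟨x, rfl⟩)
  refine ⟨Submodule.inclusion (le_sSup hK) ∘ₗ g', fun x hx ↦ Subtype.ext ?_⟩
  change (g' x).1 = _
  rw [hg' x hx]
  rfl

/-- A biproduct decomposition gives the idempotent projecting to its first factor, whose range and
kernel are complementary submodules. -/
lemma ModuleCat.indecomposable_iff (E : ModuleCat.{u} R) :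
    Indecomposable E ↔ Nontrivial E ∧ ∀ A B : Submodule R E, IsCompl A B → A = ⊥ ∨ B = ⊥ := by
  refine and_congr (by rw [ModuleCat.isZero_iff_subsingleton, not_subsingleton_iff_nontrivial]) ?_
  constructor
  · intro h A B hAB
    refine (h (ModuleCat.of R A) (ModuleCat.of R B)
      (((A.prodEquivOfIsCompl B hAB).symm.toModuleIso) ≪≫
        (ModuleCat.biprodIsoProd (ModuleCat.of R A) (ModuleCat.of R B)).symm)).imp ?_ ?_
    all_goals
      intro h
      have := ModuleCat.subsingleton_of_isZero h
      exact Submodule.eq_bot_of_subsingleton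
  · intro h Y Z e
    let P : E ⟶ E := e.hom ≫ biprod.fst ≫ biprod.inl ≫ e.inv
    let Q : E ⟶ E := e.hom ≫ biprod.snd ≫ biprod.inr ≫ e.inv
    have hP : IsIdempotentElem P.hom := by
      change P.hom ∘ₗ P.hom = P.hom
      rw [← ModuleCat.hom_comp]
      simp [P]
    refine (h _ _ (LinearMap.IsIdempotentElem.isCompl hP)).imp (fun h ↦ ?_) (fun h ↦ ?_)
    · have hP0 : P = 0 := by
        ext x
        have : P.hom x ∈ LinearMap.range P.hom := ⟨x, rfl⟩
        rw [h] at this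
        exact (Submodule.mem_bot R).1 this
      rw [IsZero.iff_id_eq_zero]
      calc 𝟙 Y = biprod.inl ≫ e.inv ≫ P ≫ e.hom ≫ biprod.fst := by simp [P]
        _ = 0 := by simp [hP0]
    · have hQ0 : Q = 0 := by
        ext x
        have hPQ : Q ≫ P = 0 := by simp [P, Q]
        have : Q.hom x ∈ LinearMap.ker P.hom := by
          rw [LinearMap.mem_ker, ← LinearMap.comp_apply, ← ModuleCat.hom_comp, hPQ]
          rfl
        rw [h] at this
        exact (Submodule.mem_bot R).1 this
      rw [IsZero.iff_id_eq_zero]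
      calc 𝟙 Z = biprod.inr ≫ e.inv ≫ Q ≫ e.hom ≫ biprod.snd := by simp [Q]
        _ = 0 := by simp [hQ0]

variable [IsNoetherianRing R]

/-- Over a noetherian ring, an injective module which contains `R ⧸ p` has an indecomposable
injective submodule with that property: divide by a maximal injective submodule which meets
`R ⧸ p` trivially. -/
lemma Module.Baer.exists_indecomposable {I : Type u} [AddCommGroup I] [Module R I]
    (hI : Module.Baer R I) {p : PrimeSpectrum R} (f₀ : (R ⧸ p.asIdeal) →ₗ[R] I)
    (hf₀ : Function.Injective f₀) :
    ∃ L : Submodule R I, Module.Baer R L ∧ Indecomposable (ModuleCat.of R L) ∧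
      ∃ f : (R ⧸ p.asIdeal) →ₗ[R] L, Function.Injective f := by
  let A : Submodule R I := LinearMap.range f₀
  obtain ⟨K, hK⟩ : ∃ K : Submodule R I,
      Maximal (· ∈ {K : Submodule R I | Module.Baer R K ∧ Disjoint K A}) K := by
    refine zorn_le₀ _ fun c hc hchain ↦ ?_
    obtain rfl | hne := c.eq_empty_or_nonempty
    · refine ⟨⊥, ⟨fun J g ↦ ⟨0, fun x hx ↦ Subsingleton.elim _ _⟩, disjoint_bot_left⟩, by simp⟩
    · refine ⟨sSup c, ⟨.sSup_of_directedOn hne hchain.directedOn fun K hK ↦ (hc hK).1, ?_⟩,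
        fun K hK ↦ le_sSup hK⟩
      rw [Submodule.disjoint_def]
      intro x hx hxA
      obtain ⟨K, hK, hxK⟩ := (Submodule.mem_sSup_of_directed hne hchain.directedOn).1 hx
      exact Submodule.disjoint_def.1 (hc hK).2 x hxK hxA
  obtain ⟨r, hr'⟩ := hK.prop.1.extension_property K.subtype K.subtype_injective LinearMap.id
  have hr (x : K) : r x = x := LinearMap.congr_fun hr' x
  let L := LinearMap.ker r
  have hLK : IsCompl L K := (LinearMap.isCompl_of_proj hr).symm
  have hA {x : R ⧸ p.asIdeal} (hx : f₀ x ∈ K) : x = 0 :=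
    hf₀ ((Submodule.disjoint_def.1 hK.prop.2 _ hx ⟨x, rfl⟩).trans (map_zero _).symm)
  let π := L.projectionOnto K hLK
  have hinj : Function.Injective (π ∘ₗ f₀) := by
    rw [injective_iff_map_eq_zero]
    exact fun x hx ↦ hA ((Submodule.projectionOnto_apply_eq_zero_iff hLK).1 hx)
  refine ⟨L, .ker r K.subtype hr' hI, ?_, π ∘ₗ f₀, hinj⟩
  have : Nontrivial (R ⧸ p.asIdeal) := Ideal.Quotient.nontrivial_iff.2 p.2.ne_top
  refine (ModuleCat.indecomposable_iff _).2 ⟨hinj.nontrivial, fun Y Z hYZ ↦ ?_⟩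
  -- The kernel of q is K + Y, an injective submodule strictly larger than K, so by maximality it
  -- meets the copy of R/p.
  have key (Y Z : Submodule R L) (hYZ : IsCompl Y Z) (hY : Y ≠ ⊥) :
      ∃ a : R, a ∉ p.asIdeal ∧ π (f₀ (Submodule.Quotient.mk a)) ∈ Y := by
    let q : I →ₗ[R] Z := Z.projectionOnto Y hYZ.symm ∘ₗ π
    have hq (x : I) : q x = 0 ↔ π x ∈ Y := Submodule.projectionOnto_apply_eq_zero_iff hYZ.symm
    have hbaer : Module.Baer R (LinearMap.ker q) := by
      refine .ker q (L.subtype ∘ₗ Z.subtype) ?_ hI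
      ext x
      simp [q, π]
    have hKq : K ≤ LinearMap.ker q := by
      intro x hx
      rw [LinearMap.mem_ker, hq, (Submodule.projectionOnto_apply_eq_zero_iff hLK).2 hx]
      exact zero_mem _
    have hnd : ¬ Disjoint (LinearMap.ker q) A := by
      intro hd
      apply hY
      rw [eq_bot_iff]
      intro y hy
      have hπy : π y = y := Submodule.projectionOnto_apply_left hLK y
      have : (y : I) ∈ LinearMap.ker q := by
        rw [LinearMap.mem_ker, hq, hπy]
        exact hy
      have hyK := hK.le_of_ge ⟨hbaer, hd⟩ hKq this
      rw [Submodule.mem_bot, ← hπy]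
      exact (Submodule.projectionOnto_apply_eq_zero_iff hLK).2 hyK
    rw [Submodule.disjoint_def] at hnd
    push Not at hnd
    obtain ⟨_, hx, ⟨x, rfl⟩, hx0⟩ := hnd
    obtain ⟨a, rfl⟩ := Submodule.Quotient.mk_surjective _ x
    refine ⟨a, fun ha ↦ hx0 ?_, (hq _).1 hx⟩
    rw [(Submodule.Quotient.mk_eq_zero _).2 ha, map_zero]
  by_contra! h
  obtain ⟨a, ha, haY⟩ := key Y Z hYZ h.1
  obtain ⟨b, hb, hbZ⟩ := key Z Y hYZ.symm h.2
  -- The class of ab lands in Y ∩ Z = 0, which would force ab ∈ p.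
  have h0 : π (f₀ (Submodule.Quotient.mk (a * b))) = 0 := by
    refine Submodule.disjoint_def.1 hYZ.disjoint _ ?_ ?_
    · rw [mul_comm, ← smul_eq_mul, Submodule.Quotient.mk_smul, map_smul, map_smul]
      exact Y.smul_mem _ haY
    · rw [← smul_eq_mul, Submodule.Quotient.mk_smul, map_smul, map_smul]
      exact Z.smul_mem _ hbZ
  have := hinj (h0.trans (map_zero (π ∘ₗ f₀)).symm)
  exact (p.2.mem_or_mem ((Submodule.Quotient.mk_eq_zero _).1 this)).elim ha hb

lemma exists_indecomposable_injective (p : PrimeSpectrum R) :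
    ∃ E : ModuleCat.{u} R, Injective E ∧ Indecomposable E ∧
      ∃ f : (R ⧸ p.asIdeal) →ₗ[R] E, Function.Injective f := by
  obtain ⟨⟨I, hI, f₀, hf₀⟩⟩ := (ModuleCat.enoughInjectives.{u} R).presentation
    (ModuleCat.of R (R ⧸ p.asIdeal))
  obtain ⟨L, hL, hL', h⟩ := Module.Baer.exists_indecomposable
    ((ModuleCat.injective_iff_baer I).1 hI) f₀.hom ((ModuleCat.mono_iff_injective _).1 hf₀)
  exact ⟨_, (ModuleCat.injective_iff_baer _).2 hL, hL', h⟩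

/-- The section functor either kills or fixes an indecomposable injective module. -/
lemma sectionFunctor_obj_eq_bot_or_top (W : Set (PrimeSpectrum R)) (E : ModuleCat.{u} R)
    [Injective E] (hE : Indecomposable E) :
    (sectionFunctor W).obj E = ⊥ ∨ (sectionFunctor W).obj E = ⊤ := by
  have h := (ModuleCat.injective_iff_baer _).1 (sectionFunctor_injective W E)
  change Module.Baer R ((sectionFunctor W).obj E) at h
  obtain ⟨r, hr⟩ := h.extension_property (Submodule.subtype _) (Submodule.subtype_injective _)
    LinearMap.id
  have hc : IsCompl ((sectionFunctor W).obj E) (LinearMap.ker r) :=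
    LinearMap.isCompl_of_proj fun x ↦ LinearMap.congr_fun hr x
  refine (((ModuleCat.indecomposable_iff E).1 hE).2 _ _ hc).imp id fun h ↦ ?_
  rw [h] at hc
  simpa using hc.sup_eq_top

/-- Over a noetherian ring, every nonzero module contains some `R ⧸ p`. -/
lemma exists_injective_quotient_prime (M : Type*) [AddCommGroup M] [Module R M] [Nontrivial M] :
    ∃ (p : PrimeSpectrum R) (f : (R ⧸ p.asIdeal) →ₗ[R] M), Function.Injective f := by
  obtain ⟨P, hP⟩ := associatedPrimes.nonempty R M
  obtain ⟨hP, x, hx⟩ := isAssociatedPrime_iff.1 hP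
  refine ⟨⟨P, hP⟩, P.liftQ (LinearMap.toSpanSingleton R _ x)
    (fun a ha ↦ by rw [hx] at ha; simpa using ha), ?_⟩
  refine LinearMap.ker_eq_bot.1 (Submodule.ker_liftQ_eq_bot _ _ _ fun a ha ↦ ?_)
  rw [hx]
  simpa using ha

omit [IsNoetherianRing R] in
/-- The sum of two independent injective submodules of an injective module is injective. -/
lemma Module.Baer.sup {I : Type*} [AddCommGroup I] [Module R I] (hI : Module.Baer R I)
    {A B : Submodule R I} (hB : Module.Baer R B) (r : I →ₗ[R] A)
    (hr : ∀ a : A, r a = a) (hBr : B ≤ LinearMap.ker r) :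
    Module.Baer R (A ⊔ B : Submodule R I) := by
  obtain ⟨t, ht⟩ := hB.extension_property B.subtype B.subtype_injective LinearMap.id
  have ht (b : B) : t b = b := LinearMap.congr_fun ht b
  refine hI.of_retract (A ⊔ B).subtype (Submodule.inclusion le_sup_left ∘ₗ r +
    Submodule.inclusion le_sup_right ∘ₗ t ∘ₗ (LinearMap.id - A.subtype ∘ₗ r)) ?_
  ext ⟨x, hx⟩
  obtain ⟨a, ha, b, hb, rfl⟩ := Submodule.mem_sup.1 hx
  have h₁ := hr ⟨a, ha⟩
  have h₂ := ht ⟨b, hb⟩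
  have h₃ : r b = 0 := hBr hb
  simp only at h₁ h₂
  simp [h₁, h₂, h₃]

omit [IsNoetherianRing R] in
lemma CategoryTheory.Indecomposable.of_iso {C : Type*} [Category* C] [HasZeroMorphisms C]
    [HasBinaryBiproducts C] {X Y : C} (e : X ≅ Y) (hX : Indecomposable X) : Indecomposable Y :=
  ⟨fun h ↦ hX.1 (h.of_iso e), fun A B e' ↦ hX.2 A B (e ≪≫ e')⟩

/-- Over a noetherian ring, a linear map from an injective module lifts along `d` if its
restrictions to all indecomposable injective submodules lift. -/
lemma Module.Baer.exists_comp_eq {I : Type u} {M N : Type*} [AddCommGroup I] [Module R I]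
    [AddCommGroup M] [Module R M] [AddCommGroup N] [Module R N] (hI : Module.Baer R I)
    (d : M →ₗ[R] N) (f : I →ₗ[R] N)
    (hf : ∀ L : Submodule R I, Module.Baer R L → Indecomposable (ModuleCat.of R L) →
      ∃ h : L →ₗ[R] M, d ∘ₗ h = f ∘ₗ L.subtype) :
    ∃ h : I →ₗ[R] M, d ∘ₗ h = f := by
  obtain ⟨h, hh⟩ : ∃ h : I →ₗ.[R] M, Maximal (· ∈ {h : I →ₗ.[R] M |
      Module.Baer R h.domain ∧ ∀ x : h.domain, d (h x) = f x}) h := by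
    refine zorn_le₀ _ fun c hc hchain ↦ ?_
    obtain rfl | hne := c.eq_empty_or_nonempty
    · exact ⟨⊥, ⟨fun J g ↦ ⟨0, fun x hx ↦ Subsingleton.elim (α := (⊥ : Submodule R I)) _ _⟩,
        fun x ↦ by simp [Subsingleton.elim (α := (⊥ : Submodule R I)) x 0]⟩, by simp⟩
    · refine ⟨LinearPMap.sSup c hchain.directedOn, ⟨?_, ?_⟩, fun _ ↦ LinearPMap.le_sSup _⟩
      · rw [LinearPMap.domain_sSup]
        refine .sSup_of_directedOn (hne.image _) ?_ ?_
        · exact directedOn_image.2 (hchain.directedOn.mono fun _ _ h ↦ h.1)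
        · rintro _ ⟨h, hh, rfl⟩
          exact (hc hh).1
      · rintro ⟨x, hx⟩
        obtain ⟨h, hh, hx'⟩ := (LinearPMap.mem_domain_sSup_iff hne hchain.directedOn).1 hx
        rw [← (hc hh).2 ⟨x, hx'⟩]
        exact congr_arg d (LinearPMap.sSup_apply hchain.directedOn hh ⟨x, hx'⟩)
  obtain ⟨r, hr⟩ := hh.prop.1.extension_property h.domain.subtype h.domain.subtype_injective
    LinearMap.id
  have hc : IsCompl h.domain (LinearMap.ker r) :=
    LinearMap.isCompl_of_proj fun x ↦ LinearMap.congr_fun hr x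
  -- A nonzero complement of the maximal domain contains some R/p, hence an indecomposable injective
  -- over which the lift extends. This stands in for a decomposition of I into a direct sum.
  have hker : LinearMap.ker r = ⊥ := by
    by_contra hne
    have : Nontrivial (LinearMap.ker r) := Submodule.nontrivial_iff_ne_bot.2 hne
    obtain ⟨p, g, hg⟩ := exists_injective_quotient_prime (R := R) (LinearMap.ker r)
    obtain ⟨L, hL, hL', -⟩ :=
      (Module.Baer.ker r h.domain.subtype hr hI).exists_indecomposable g hg
    let e : L ≃ₗ[R] L.map (LinearMap.ker r).subtype :=
      L.equivMapOfInjective _ (Submodule.subtype_injective _)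
    have hLe : Module.Baer R (L.map (LinearMap.ker r).subtype) :=
      hL.of_retract e.symm.toLinearMap e.toLinearMap (by ext; simp)
    obtain ⟨h', hh'⟩ := hf _ hLe (.of_iso e.toModuleIso hL')
    let k : I →ₗ.[R] M := ⟨_, h'⟩
    have hle : L.map (LinearMap.ker r).subtype ≤ LinearMap.ker r := Submodule.map_subtype_le _ _
    have hdisj : Disjoint h.domain k.domain := hc.disjoint.mono_right hle
    have hsup := h.sup_h_of_disjoint k hdisj
    have hmem : h.sup k hsup ∈ {h : I →ₗ.[R] M |
        Module.Baer R h.domain ∧ ∀ x : h.domain, d (h x) = f x} := by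
      refine ⟨hI.sup hLe r (fun a ↦ LinearMap.congr_fun hr a) hle, ?_⟩
      rintro ⟨x, hx⟩
      obtain ⟨a, ha, b, hb, rfl⟩ := Submodule.mem_sup.1 hx
      have := LinearPMap.sup_apply hsup ⟨a, ha⟩ ⟨b, hb⟩ ⟨a + b, hx⟩ rfl
      refine (congr_arg d this).trans ?_
      rw [map_add, hh.prop.2, map_add]
      exact congr_arg (f a + ·) (LinearMap.congr_fun hh' ⟨b, hb⟩)
    have hkh : k.domain ≤ h.domain := (LinearPMap.right_le_sup h k hsup).1.trans
      (hh.le_of_ge hmem (LinearPMap.left_le_sup h k hsup)).1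
    have : Nontrivial L := ((ModuleCat.indecomposable_iff _).1 hL').1
    exact Submodule.nontrivial_iff_ne_bot.1 e.symm.toEquiv.nontrivial (hdisj.eq_bot_of_ge hkh)
  have htop : h.domain = ⊤ := by simpa [hker] using hc.sup_eq_top
  refine ⟨h.toFun ∘ₗ LinearMap.codRestrict h.domain LinearMap.id fun x ↦ htop ▸ trivial, ?_⟩
  ext x
  exact hh.prop.2 ⟨x, _⟩

end Hull

/-! ### Torsion in complexes of injectives. -/

section Complexes

variable {R : Type u} [CommRing R] {W : Set (PrimeSpectrum R)}

/-- An object of `R`-modules is `W`-torsion if all its elements are. -/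
def ModuleCat.IsTors (W : Set (PrimeSpectrum R)) (M : ModuleCat.{u} R) : Prop :=
  ∀ x : M, _root_.IsTors W x

lemma ModuleCat.IsTors.of_mono {M N : ModuleCat.{u} R} (hN : ModuleCat.IsTors W N) (f : M ⟶ N)
    [Mono f] : ModuleCat.IsTors W M := fun x ↦
  (hN (f x)).of_map f.hom ((ModuleCat.mono_iff_injective f).1 inferInstance)

lemma ModuleCat.IsTors.of_epi {M N : ModuleCat.{u} R} (hM : ModuleCat.IsTors W M) (f : M ⟶ N)
    [Epi f] : ModuleCat.IsTors W N := fun y ↦ by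
  obtain ⟨x, rfl⟩ := (ModuleCat.epi_iff_surjective f).1 inferInstance y
  exact (hM x).map f.hom

lemma ModuleCat.IsTors.of_exact {S : ShortComplex (ModuleCat.{u} R)} (hS : S.Exact)
    (h₁ : ModuleCat.IsTors W S.X₁) (h₃ : ModuleCat.IsTors W S.X₃) : ModuleCat.IsTors W S.X₂ :=
  isTors_of_exact ((ShortComplex.ShortExact.moduleCat_exact_iff_function_exact _).1 hS) h₁ h₃

lemma ModuleCat.isTors_of_isZero {M : ModuleCat.{u} R} (hM : IsZero M) :
    ModuleCat.IsTors W M := fun x ↦ by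
  have := ModuleCat.subsingleton_of_isZero hM
  rw [Subsingleton.elim x 0]
  exact isTors_zero

lemma ModuleCat.IsTors.homology {S : ShortComplex (ModuleCat.{u} R)}
    (h : ModuleCat.IsTors W S.X₂) : ModuleCat.IsTors W S.homology :=
  (h.of_mono S.iCycles).of_epi S.homologyπ

lemma CategoryTheory.ShortComplex.exists_smul_mem_range {S : ShortComplex (ModuleCat.{u} R)}
    (h : ModuleCat.IsTors W S.homology) (x : S.X₂) (hx : S.g x = 0) (p : PrimeSpectrum R)
    (hp : p ∉ W) : ∃ r ∉ p.asIdeal, r • x ∈ LinearMap.range S.f.hom := by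
  let z : S.cycles := S.moduleCatCyclesIso.inv ⟨x, hx⟩
  have hz : S.iCycles z = x := by
    exact congr_arg (fun f ↦ f.hom ⟨x, hx⟩) S.moduleCatCyclesIso_inv_iCycles
  obtain ⟨r, hr, hrz⟩ := h (S.homologyπ z) p hp
  refine ⟨r, hr, ?_⟩
  rw [← ShortComplex.moduleCat_pOpcycles_eq_zero_iff]
  have h1 : S.homologyι (S.homologyπ z) = S.pOpcycles x := by
    rw [← hz, ← ConcreteCategory.comp_apply, ← ConcreteCategory.comp_apply, S.homology_π_ι]
  rw [map_smul, ← h1, ← map_smul, hrz, map_zero]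

/-- A bounded below complex of injective `W`-torsion-free modules with `W`-torsion homology is
acyclic. -/
lemma acyclic_of_torsionFree (J : CochainComplex (ModuleCat.{u} R) ℤ) (a : ℤ) [J.IsStrictlyGE a]
    (hJ : ∀ n, Module.Baer R (J.X n)) (htf : ∀ n (x : J.X n), IsTors W x → x = 0)
    (hH : ∀ n, ModuleCat.IsTors W (J.homology n)) : J.Acyclic := by
  -- An injective image has a retraction r. A multiplier s that puts s x into the image kills x - r
  -- x, so torsion-freeness gives x = r x.
  have exact_of_baer (i j k : ℤ) (hij : i + 1 = j) (hjk : j + 1 = k)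
      (hB : Module.Baer R (LinearMap.range (J.d i j).hom)) (x : J.X j) (hx : J.d j k x = 0) :
      x ∈ LinearMap.range (J.d i j).hom := by
    obtain ⟨r, hr⟩ := hB.extension_property (Submodule.subtype _) (Submodule.subtype_injective _)
      LinearMap.id
    have hr (y) (hy : y ∈ LinearMap.range (J.d i j).hom) : (r y).1 = y :=
      congr_arg Subtype.val (LinearMap.congr_fun hr ⟨y, hy⟩)
    have h0 : x - (r x).1 = 0 := by
      refine htf j _ fun p hp ↦ ?_
      let e : J.homology j ≅ (J.sc' i j k).homology := ShortComplex.homologyMapIso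
        (J.isoSc' i j k (by simp [← hij]) (by simp [hjk]))
      have hh : ModuleCat.IsTors W (J.sc' i j k).homology := (hH j).of_mono e.inv
      obtain ⟨s, hs, hsx⟩ := ShortComplex.exists_smul_mem_range hh x hx p hp
      refine ⟨s, hs, ?_⟩
      have hrs : (r (s • x)).1 = s • x := hr _ hsx
      rw [r.map_smul] at hrs
      rw [smul_sub, sub_eq_zero]
      exact hrs.symm
    rw [sub_eq_zero.1 h0]
    exact (r x).2
  -- Exactness at j' identifies the next image with the quotient of J.X j' by the previous,
  -- injective image. This quotient is a direct summand of J.X j', hence injective.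
  have baer (j : ℤ) (hj : a ≤ j) :
      ∀ i, i + 1 = j → Module.Baer R (LinearMap.range (J.d i j).hom) := by
    induction j, hj using Int.leInduction with
    | base =>
      intro i hi I g
      have : J.d i a = 0 := (J.isZero_of_isStrictlyGE a i (by lia)).eq_of_src _ _
      have : Subsingleton (LinearMap.range (J.d i a).hom) := by
        rw [this]
        simp only [ModuleCat.hom_zero, LinearMap.range_zero]
        infer_instance
      exact ⟨0, fun x hx ↦ Subsingleton.elim _ _⟩
    | succ j hj ih =>
      intro j' hj'
      obtain rfl : j' = j := by lia
      have hB := ih (j' - 1) (by lia)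
      obtain ⟨r, hr⟩ := hB.extension_property (Submodule.subtype _)
        (Submodule.subtype_injective _) LinearMap.id
      have hr (y) (hy : y ∈ LinearMap.range (J.d (j' - 1) j').hom) : (r y).1 = y :=
        congr_arg Subtype.val (LinearMap.congr_fun hr ⟨y, hy⟩)
      have hle : LinearMap.ker (J.d j' (j' + 1)).hom ≤
          LinearMap.ker (LinearMap.id - (Submodule.subtype _) ∘ₗ r) := by
        intro x hx
        have := hr _ (exact_of_baer (j' - 1) j' (j' + 1) (by lia) rfl hB x hx)
        simp [this]
      have hdr (x : J.X j') : J.d j' (j' + 1) (r x).1 = 0 := by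
        obtain ⟨y, hy⟩ := (r x).2
        rw [← hy]
        change (J.d (j' - 1) j' ≫ J.d j' (j' + 1)).hom y = 0
        simp
      refine (hJ j').of_retract ((LinearMap.ker _).liftQ _ hle ∘ₗ
        (LinearMap.quotKerEquivRange (J.d j' (j' + 1)).hom).symm.toLinearMap)
        (LinearMap.rangeRestrict _) ?_
      ext ⟨_, x, rfl⟩
      have : (LinearMap.quotKerEquivRange (J.d j' (j' + 1)).hom).symm
          ⟨(J.d j' (j' + 1)).hom x, x, rfl⟩ = Submodule.Quotient.mk x := by
        rw [LinearEquiv.symm_apply_eq]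
        rfl
      simp [this, hdr]
  intro j
  by_cases hj : a ≤ j
  · rw [J.exactAt_iff' (j - 1) j (j + 1) (by simp) (by simp), ShortComplex.moduleCat_exact_iff]
    exact fun x hx ↦ exact_of_baer (j - 1) j (j + 1) (by lia) rfl (baer j hj _ (by lia)) x hx
  · exact ShortComplex.exact_of_isZero_X₂ _ (J.isZero_of_isStrictlyGE a j (by lia))

/-- The inclusion of the complex obtained by applying a preradical functor degreewise. -/
def PreradicalFunctor.inclComplex (γ : PreradicalFunctor R)
    (K : CochainComplex (ModuleCat.{u} R) ℤ) :
    (γ.toFunctor.mapHomologicalComplex (.up ℤ)).obj K ⟶ K where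
  f i := γ.incl.app (K.X i)
  comm' i j _ := (γ.incl.naturality (K.d i j)).symm

instance (γ : PreradicalFunctor R) (K : CochainComplex (ModuleCat.{u} R) ℤ) :
    Mono (γ.inclComplex K) :=
  HomologicalComplex.mono_of_mono_f _ fun i ↦ inferInstanceAs (Mono (γ.incl.app (K.X i)))

lemma DerivedCategory.isZero_of_homology {C : Type*} [Category* C] [Abelian C]
    [HasDerivedCategory C] (X : DerivedCategory C)
    (h : ∀ n, IsZero ((homologyFunctor C n).obj X)) : IsZero X := by
  have : IsIso (0 : X ⟶ X) := by
    rw [isIso_iff]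
    intro n
    exact ⟨0, (h n).eq_of_src _ _, (h n).eq_of_src _ _⟩
  rw [IsZero.iff_id_eq_zero, ← cancel_mono (0 : X ⟶ X)]
  simp

/-- The quotient K / Γ_W K is a bounded below complex of torsion-free injectives, and the long exact
sequence makes its homology torsion. It is therefore acyclic. -/
lemma isIso_Q_map_inclComplex [IsNoetherianRing R] [HasDerivedCategory.{w} (ModuleCat.{u} R)]
    (K : CochainComplex (ModuleCat.{u} R) ℤ) (a : ℤ) [K.IsStrictlyGE a]
    [∀ n, Injective (K.X n)] (hH : ∀ n, ModuleCat.IsTors W (K.homology n)) :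
    IsIso (DerivedCategory.Q.map ((sectionFunctor W).inclComplex K)) := by
  let γ := sectionFunctor W
  let S : ShortComplex (CochainComplex (ModuleCat.{u} R) ℤ) :=
    ShortComplex.mk (γ.inclComplex K) (cokernel.π (γ.inclComplex K)) (by simp)
  have hS : S.ShortExact := { exact := ShortComplex.exact_cokernel _ }
  have hSn (n : ℤ) := (HomologicalComplex.shortExact_iff_degreewise_shortExact S).1 hS n
  have hΓ (n : ℤ) : ModuleCat.IsTors W (S.X₁.X n) := fun x ↦
    .of_map _ (Submodule.subtype_injective _) ((mem_sectionFunctor_iff _).1 x.2)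
  have hsurj (n : ℤ) : Function.Surjective (S.g.f n) := (hSn n).moduleCat_surjective_g
  have hex (n : ℤ) : Function.Exact (S.f.f n) (S.g.f n) :=
    (ShortComplex.ShortExact.moduleCat_exact_iff_function_exact _).1 (hSn n).exact
  have : S.X₃.IsStrictlyGE a := by
    rw [CochainComplex.isStrictlyGE_iff]
    intro i hi
    have := (hSn i).epi_g
    exact IsZero.of_epi (S.g.f i) (K.isZero_of_isStrictlyGE a i hi)
  have h₃ : S.X₃.Acyclic := by
    refine acyclic_of_torsionFree (W := W) S.X₃ a (fun n ↦ ?_) (fun n x hx ↦ ?_) (fun n ↦ ?_)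
    · have : Injective (S.map (HomologicalComplex.eval _ _ n)).X₁ :=
        sectionFunctor_injective W (K.X n)
      let s := (hSn n).splittingOfInjective
      refine ((ModuleCat.injective_iff_baer (K.X n)).1 inferInstance).of_retract s.s.hom
        (S.g.f n).hom ?_
      have := s.s_g
      exact congr_arg ModuleCat.Hom.hom this
    · obtain ⟨y, rfl⟩ := hsurj n x
      refine (hex n y).2 ⟨⟨y, (mem_sectionFunctor_iff _).2 (.of_smul fun p hp ↦ ?_)⟩, rfl⟩
      obtain ⟨r, hr, h0⟩ := hx p hp
      obtain ⟨z, hz⟩ := (hex n (r • y)).1 (by rw [map_smul, h0])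
      exact ⟨r, hr, hz ▸ (hΓ n z).map (S.f.f n).hom⟩
    · refine ModuleCat.IsTors.of_exact (hS.homology_exact₃ n (n + 1) (by simp)) (hH n) ?_
      exact ModuleCat.IsTors.homology (hΓ (n + 1))
  have hz : IsZero (DerivedCategory.Q.obj S.X₃) := by
    refine DerivedCategory.isZero_of_homology _ fun n ↦ ?_
    exact ((h₃ n).isZero_homology).of_iso ((DerivedCategory.homologyFunctorFactors _ n).app S.X₃)
  exact (Pretriangulated.Triangle.isZero₃_iff_isIso₁ _
    (DerivedCategory.triangleOfSES_distinguished hS)).1 hz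

end Complexes

/-! ### The counit 𝐑Γ_W → id. -/

section Counit

variable {R : Type u} [CommRing R]

lemma PreradicalFunctor.inclComplex_naturality (γ : PreradicalFunctor R)
    {K L : CochainComplex (ModuleCat.{u} R) ℤ} (f : K ⟶ L) :
    (γ.toFunctor.mapHomologicalComplex (.up ℤ)).map f ≫ γ.inclComplex L =
      γ.inclComplex K ≫ f := by
  ext i : 1
  exact γ.incl.naturality (f.f i)

/-- The inclusion of a preradical functor on the bounded below homotopy category. -/
def PreradicalFunctor.inclHomotopy (γ : PreradicalFunctor R) :
    γ.toFunctor.mapHomotopyCategoryPlus ⟶ 𝟭 (HomotopyCategory.Plus (ModuleCat.{u} R)) where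
  app K := ObjectProperty.homMk ((HomotopyCategory.quotient _ _).map (γ.inclComplex K.obj.as))
  naturality K L f := by
    obtain ⟨K, rfl⟩ := HomotopyCategory.Plus.quotient_obj_surjective K
    obtain ⟨L, rfl⟩ := HomotopyCategory.Plus.quotient_obj_surjective L
    obtain ⟨f, rfl⟩ := (HomotopyCategory.Plus.quotient _).map_surjective f
    apply ObjectProperty.hom_ext
    exact congr_arg (HomotopyCategory.quotient _ _).map (γ.inclComplex_naturality f.hom)

variable [HasDerivedCategory.{w} (ModuleCat.{u} R)]

open DerivedCategory

/-- The inclusion of a preradical functor on the homotopy category, localized. -/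
noncomputable def PreradicalFunctor.inclDerived (γ : PreradicalFunctor R) :
    γ.toFunctor.mapHomotopyCategoryPlus ⋙ Plus.Qh ⟶ Plus.Qh ⋙ 𝟭 (Plus (ModuleCat.{u} R)) :=
  Functor.whiskerRight γ.inclHomotopy Plus.Qh

/-- The natural transformation from the right derived functor of a preradical functor to the
identity functor. -/
noncomputable def PreradicalFunctor.derivedCounit (γ : PreradicalFunctor R) :
    γ.toFunctor.rightDerivedFunctorPlus ⟶ 𝟭 (Plus (ModuleCat.{u} R)) :=
  Functor.rightDerivedDesc _ γ.toFunctor.rightDerivedFunctorPlusUnit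
    (HomotopyCategory.Plus.quasiIso _) _ γ.inclDerived

/-- On a complex of injectives the unit is invertible, so there the counit is identified with the
degreewise inclusion γ K → K. -/
lemma PreradicalFunctor.unit_derivedCounit (γ : PreradicalFunctor R)
    (K : HomotopyCategory.Plus (ModuleCat.{u} R)) :
    γ.toFunctor.rightDerivedFunctorPlusUnit.app K ≫ γ.derivedCounit.app (Plus.Qh.obj K) =
      Plus.Qh.map (γ.inclHomotopy.app K) :=
  Functor.rightDerived_fac_app _ _ (HomotopyCategory.Plus.quasiIso _) _ γ.inclDerived K

lemma DerivedCategory.Plus.exists_injective_complex (X : Plus (ModuleCat.{u} R)) :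
    ∃ K : CochainComplex.Plus (ModuleCat.{u} R), (∀ n, Injective (K.obj.X n)) ∧
      Nonempty (Plus.Q.obj K ≅ X) := by
  obtain ⟨n, hn⟩ := X.2
  have : X.IsGE n := (isGE_ι_obj_iff X n).1 hn
  obtain ⟨L, _, ⟨e⟩⟩ := exists_injective_nonempty_iso X n
  exact ⟨_, fun n ↦ inferInstanceAs (Injective ((InjectiveObject.ι _).obj (L.obj.X n))), ⟨e⟩⟩

/-- The homology of the image of a complex in the bounded below derived category. -/
noncomputable def DerivedCategory.Plus.homologyQIso (K : CochainComplex.Plus (ModuleCat.{u} R))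
    (n : ℤ) : (Plus.homologyFunctor _ n).obj (Plus.Q.obj K) ≅ K.obj.homology n :=
  (DerivedCategory.homologyFunctor _ n).mapIso ((quotientCompQhIso _).app K.obj) ≪≫
    (homologyFunctorFactors _ n).app K.obj

/-- Objects of the bounded below derived category with `W`-torsion homology. -/
def torsionObjects (W : Set (PrimeSpectrum R)) : ObjectProperty (Plus (ModuleCat.{u} R)) :=
  fun X ↦ ∀ n, ModuleCat.IsTors W ((Plus.homologyFunctor _ n).obj X)

instance (W : Set (PrimeSpectrum R)) : (torsionObjects W).IsClosedUnderIsomorphisms where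
  of_iso e h n := (h n).of_mono ((Plus.homologyFunctor _ n).map e.inv)

/-- The right derived functor of a section functor. -/
noncomputable abbrev derivedSection (W : Set (PrimeSpectrum R)) :
    Plus (ModuleCat.{u} R) ⥤ Plus (ModuleCat.{u} R) :=
  (sectionFunctor W).toFunctor.rightDerivedFunctorPlus

variable {W : Set (PrimeSpectrum R)}

lemma torsionObjects_derivedSection (X : Plus (ModuleCat.{u} R)) :
    torsionObjects W ((derivedSection W).obj X) := by
  obtain ⟨K, hK, ⟨e⟩⟩ := X.exists_injective_complex
  refine (torsionObjects W).prop_of_iso ((asIso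
    ((sectionFunctor W).toFunctor.rightDerivedFunctorPlusUnit.app
      ((HomotopyCategory.Plus.quotient _).obj K))) ≪≫ (derivedSection W).mapIso e) fun n ↦ ?_
  have h : ModuleCat.IsTors W
      (((sectionFunctor W).toFunctor.mapCochainComplexPlus.obj K).obj.homology n) :=
    ModuleCat.IsTors.homology fun x ↦ .of_map _ (Submodule.subtype_injective _)
      ((mem_sectionFunctor_iff _).1 x.2)
  have h' : ModuleCat.IsTors W ((Plus.homologyFunctor _ n).obj
      (Plus.Q.obj ((sectionFunctor W).toFunctor.mapCochainComplexPlus.obj K))) :=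
    h.of_mono (Plus.homologyQIso _ n).hom
  exact h'

variable [IsNoetherianRing R]

lemma isIso_derivedCounit_app {X : Plus (ModuleCat.{u} R)} (hX : torsionObjects W X) :
    IsIso ((sectionFunctor W).derivedCounit.app X) := by
  obtain ⟨K, hK, ⟨e⟩⟩ := X.exists_injective_complex
  rw [← NatTrans.isIso_app_iff_of_iso _ e]
  have h₁ := (sectionFunctor W).unit_derivedCounit ((HomotopyCategory.Plus.quotient _).obj K)
  have h₂ : IsIso (Plus.Qh.map ((sectionFunctor W).inclHomotopy.app
      ((HomotopyCategory.Plus.quotient _).obj K))) := by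
    rw [← isIso_iff_of_reflects_iso _ Plus.ι]
    obtain ⟨a, ha⟩ := K.2
    have := isIso_Q_map_inclComplex (W := W) K.obj a fun n ↦
      (hX n).of_mono ((Plus.homologyQIso K n).inv ≫ (Plus.homologyFunctor _ n).map e.hom)
    exact ((MorphismProperty.isomorphisms _).arrow_mk_iso_iff
      (((Functor.mapArrowFunctor _ _).mapIso (quotientCompQhIso _)).app
        (Arrow.mk ((sectionFunctor W).inclComplex K.obj)))).1 this
  have h₃ : IsIso ((sectionFunctor W).toFunctor.rightDerivedFunctorPlusUnit.app
      ((HomotopyCategory.Plus.quotient _).obj K) ≫ (sectionFunctor W).derivedCounit.app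
        (Plus.Qh.obj ((HomotopyCategory.Plus.quotient _).obj K))) := by
    rw [h₁]
    exact h₂
  have h₄ : IsIso ((sectionFunctor W).toFunctor.rightDerivedFunctorPlusUnit.app
      ((HomotopyCategory.Plus.quotient _).obj K)) := inferInstance
  exact @IsIso.of_isIso_comp_left _ _ _ _ _ _ _ h₄ h₃

omit [HasDerivedCategory.{w} (ModuleCat.{u} R)] [IsNoetherianRing R] in
lemma isIso_sectionFunctor_map_incl (M : ModuleCat.{u} R) :
    IsIso ((sectionFunctor W).toFunctor.map ((sectionFunctor W).incl.app M)) := by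
  rw [ConcreteCategory.isIso_iff_bijective]
  constructor
  · rintro x y h
    exact Subtype.ext (Subtype.ext (congr_arg Subtype.val h))
  · rintro ⟨x, hx⟩
    refine ⟨⟨⟨x, hx⟩, (mem_sectionFunctor_iff _).2 ?_⟩, rfl⟩
    exact .of_map (Submodule.subtype _) (Submodule.subtype_injective _)
      ((mem_sectionFunctor_iff x).1 hx)

omit [IsNoetherianRing R] [HasDerivedCategory.{w} (ModuleCat.{u} R)] in
lemma isIso_mapHomotopyCategoryPlus_map_inclHomotopy
    (K : HomotopyCategory.Plus (ModuleCat.{u} R)) :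
    IsIso ((sectionFunctor W).toFunctor.mapHomotopyCategoryPlus.map
      ((sectionFunctor W).inclHomotopy.app K)) := by
  obtain ⟨K, rfl⟩ := HomotopyCategory.Plus.quotient_obj_surjective K
  rw [← isIso_iff_of_reflects_iso _ (HomotopyCategory.Plus.ι _)]
  have (n : ℤ) : IsIso ((((sectionFunctor W).toFunctor.mapHomologicalComplex (.up ℤ)).map
      ((sectionFunctor W).inclComplex K.obj)).f n) :=
    isIso_sectionFunctor_map_incl (W := W) (K.obj.X n)
  have : IsIso (((sectionFunctor W).toFunctor.mapHomologicalComplex (.up ℤ)).map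
      ((sectionFunctor W).inclComplex K.obj)) :=
    HomologicalComplex.Hom.isIso_of_components _
  exact inferInstanceAs (IsIso ((HomotopyCategory.quotient _ _).map
    (((sectionFunctor W).toFunctor.mapHomologicalComplex (.up ℤ)).map
      ((sectionFunctor W).inclComplex K.obj))))

/-- Γ_W is idempotent, and Γ_W K is again a complex of injectives, so applying Γ_W to Γ_W K → K
computes this map. -/
lemma isIso_derivedSection_map_derivedCounit_app (X : Plus (ModuleCat.{u} R)) :
    IsIso ((derivedSection W).map ((sectionFunctor W).derivedCounit.app X)) := by
  obtain ⟨K, hK, ⟨e⟩⟩ := X.exists_injective_complex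
  let K' := (HomotopyCategory.Plus.quotient _).obj K
  let α := (sectionFunctor W).toFunctor.rightDerivedFunctorPlusUnit
  have h₁ := (sectionFunctor W).unit_derivedCounit K'
  have h₂ : α.app _ ≫ (derivedSection W).map _ = _ ≫ α.app _ :=
    (α.naturality ((sectionFunctor W).inclHomotopy.app K')).symm
  have hK' (n : ℤ) : Injective
      (((sectionFunctor W).toFunctor.mapHomotopyCategoryPlus.obj K').obj.as.X n) :=
    sectionFunctor_injective W (K.obj.X n)
  have i₁ : IsIso (α.app ((sectionFunctor W).toFunctor.mapHomotopyCategoryPlus.obj K')) :=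
    inferInstance
  have i₂ : IsIso (α.app K') := inferInstance
  have i₃ := isIso_mapHomotopyCategoryPlus_map_inclHomotopy (W := W) K'
  have i₄ : IsIso ((derivedSection W).map
      (α.app K' ≫ (sectionFunctor W).derivedCounit.app (Plus.Qh.obj K'))) := by
    have : IsIso (α.app ((sectionFunctor W).toFunctor.mapHomotopyCategoryPlus.obj K') ≫
        (derivedSection W).map (Plus.Qh.map ((sectionFunctor W).inclHomotopy.app K'))) := by
      refine h₂ ▸ @IsIso.comp_isIso _ _ _ _ _ _ _ ?_ i₂
      exact inferInstanceAs (IsIso (Plus.Qh.map _))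
    rw [h₁]
    exact IsIso.of_isIso_comp_left (α.app _) _
  rw [Functor.map_comp] at i₄
  have i₅ := IsIso.of_isIso_comp_left ((derivedSection W).map (α.app K')) ((derivedSection W).map
    ((sectionFunctor W).derivedCounit.app (Plus.Qh.obj K')))
  exact (NatTrans.isIso_app_iff_of_iso
    (Functor.whiskerRight (sectionFunctor W).derivedCounit (derivedSection W)) e).1 i₅

/-- Composition with the counit `𝐑Γ_W Y ⟶ Y` is bijective on morphisms from objects with
`W`-torsion homology. -/
lemma bijective_comp_derivedCounit {X : Plus (ModuleCat.{u} R)} (hX : torsionObjects W X)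
    (Y : Plus (ModuleCat.{u} R)) :
    Function.Bijective (fun f : X ⟶ (derivedSection W).obj Y ↦
      f ≫ (sectionFunctor W).derivedCounit.app Y) := by
  let ε := (sectionFunctor W).derivedCounit
  have : IsIso (ε.app X) := isIso_derivedCounit_app hX
  have := isIso_derivedSection_map_derivedCounit_app (W := W) Y
  -- Naturality gives ε_X ≫ f = 𝐑Γ_W(f) ≫ ε. Since ε_X is invertible, f is determined by 𝐑Γ_W(f),
  -- and 𝐑Γ_W(ε_Y) is invertible.
  constructor
  · intro f g h
    have h := congr_arg (derivedSection W).map h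
    simp only [Functor.map_comp, cancel_mono] at h
    have nat (f : X ⟶ (derivedSection W).obj Y) :
        (derivedSection W).map f ≫ ε.app _ = ε.app X ≫ f := ε.naturality f
    rw [← cancel_epi (ε.app X), ← nat, ← nat, h]
  · intro f
    refine ⟨inv (ε.app X) ≫ (derivedSection W).map f, ?_⟩
    have nat : (derivedSection W).map f ≫ ε.app _ = ε.app X ≫ f := ε.naturality f
    simp [ε] at nat ⊢

end Counit

/-! ### 𝐑Γ_W as a coreflection onto objects with torsion homology. -/

section Torsion

open DerivedCategory Pretriangulated

variable {R : Type u} [CommRing R] [HasDerivedCategory.{w} (ModuleCat.{u} R)]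

/-- The homology of a shifted object of the bounded below derived category. -/
noncomputable def DerivedCategory.Plus.homologyShiftIso {C : Type*} [Category* C] [Abelian C]
    [HasDerivedCategory C] (X : Plus C) (a n m : ℤ) (h : a + n = m) :
    (Plus.homologyFunctor C n).obj (X⟦a⟧) ≅ (Plus.homologyFunctor C m).obj X :=
  ((Plus.homologyFunctor C 0).shiftIso a n m h).app X

lemma DerivedCategory.Plus.isZero_of_homology {C : Type*} [Category* C] [Abelian C]
    [HasDerivedCategory C] {X : Plus C} (h : ∀ n, IsZero ((Plus.homologyFunctor C n).obj X)) :
    IsZero X := by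
  have := DerivedCategory.isZero_of_homology (Plus.ι.obj X) h
  rw [IsZero.iff_id_eq_zero] at this ⊢
  exact Plus.ι.map_injective (by simpa using this)

variable (W : Set (PrimeSpectrum R))

instance : (torsionObjects W).IsStableUnderShift ℤ where
  isStableUnderShiftBy a := ⟨fun X hX n ↦ (hX (a + n)).of_mono (X.homologyShiftIso a n _ rfl).hom⟩

instance : (torsionObjects W).ContainsZero where
  exists_zero := ⟨_, isZero_zero _, fun _ ↦
    ModuleCat.isTors_of_isZero (Functor.map_isZero _ (isZero_zero _))⟩

instance : (torsionObjects W).IsTriangulatedClosed₂ :=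
  .mk' fun T hT h₁ h₃ n ↦ .of_exact ((Plus.homologyFunctor _ n).map_distinguished_exact T hT)
    (h₁ n) (h₃ n)

instance : (torsionObjects W).IsTriangulated where

/-- The right derived functor of a section functor as a functor to the category of objects with
torsion homology. -/
noncomputable def torsionCoreflector :
    Plus (ModuleCat.{u} R) ⥤ (torsionObjects W).FullSubcategory :=
  (torsionObjects W).lift (derivedSection W) torsionObjects_derivedSection

/-- The right derived functor of a section functor in terms of the coreflection. -/
noncomputable def torsionCoreflectorCompιIso :
    torsionCoreflector W ⋙ (torsionObjects W).ι ≅ derivedSection W :=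
  (torsionObjects W).liftCompιIso _ _

variable [IsNoetherianRing R]

variable {W} in
/-- Composition with the counit as a bijection of morphism sets. -/
noncomputable def torsionHomEquiv (X : (torsionObjects W).FullSubcategory)
    (Y : Plus (ModuleCat.{u} R)) : (X ⟶ (torsionCoreflector W).obj Y) ≃ (X.obj ⟶ Y) :=
  (torsionObjects W).fullyFaithfulι.homEquiv.trans
    (.ofBijective _ (bijective_comp_derivedCounit X.property Y))

variable {W} in
lemma torsionHomEquiv_apply {X : (torsionObjects W).FullSubcategory}
    {Y : Plus (ModuleCat.{u} R)} (f : X ⟶ (torsionCoreflector W).obj Y) :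
    torsionHomEquiv X Y f = f.hom ≫ (sectionFunctor W).derivedCounit.app Y := rfl

/-- The objects with torsion homology form a coreflective subcategory. -/
noncomputable def torsionAdjunction : (torsionObjects W).ι ⊣ torsionCoreflector W :=
  Adjunction.mkOfHomEquiv
    { homEquiv X Y := (torsionHomEquiv X Y).symm
      homEquiv_naturality_left_symm f g := Category.assoc f.hom g.hom _
      homEquiv_naturality_right f g := by
        rw [Equiv.symm_apply_eq, torsionHomEquiv_apply]
        have h := (torsionHomEquiv _ _).apply_symm_apply f
        rw [torsionHomEquiv_apply] at h
        refine (congr_arg (· ≫ g) h.symm).trans ?_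
        exact (Category.assoc _ _ _).trans ((congr_arg (_ ≫ ·)
          ((sectionFunctor W).derivedCounit.naturality g).symm).trans
          (Category.assoc _ _ _).symm) }

lemma essImage_derivedSection : (derivedSection W).essImage = torsionObjects W := by
  ext X
  constructor
  · rintro ⟨Y, ⟨e⟩⟩
    exact (torsionObjects W).prop_of_iso e (torsionObjects_derivedSection Y)
  · intro hX
    have := isIso_derivedCounit_app hX
    exact ⟨X, ⟨asIso ((sectionFunctor W).derivedCounit.app X)⟩⟩

/-- The right adjoint of the inclusion of a triangulated subcategory is triangulated; the shift
structure is transported from the coreflection. -/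
lemma exists_isTriangulated_derivedSection :
    ∃ _ : (derivedSection W).CommShift ℤ, (derivedSection W).IsTriangulated := by
  let : (torsionCoreflector W).CommShift ℤ := (torsionAdjunction W).rightAdjointCommShift ℤ
  have : (torsionAdjunction W).CommShift ℤ :=
    (torsionAdjunction W).commShift_of_leftAdjoint ℤ
  have := (torsionAdjunction W).isTriangulated_rightAdjoint
  let := Functor.CommShift.ofIso (torsionCoreflectorCompιIso W) ℤ
  have := Functor.CommShift.ofIso_compatibility (torsionCoreflectorCompιIso W) ℤ
  exact ⟨inferInstance, Functor.isTriangulated_of_iso (torsionCoreflectorCompιIso W)⟩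

omit [IsNoetherianRing R] in
lemma torsionObjects_singleFunctor_iff (n : ℤ) (M : ModuleCat.{u} R) :
    torsionObjects W ((Plus.singleFunctor _ n).obj M) ↔ ModuleCat.IsTors W M := by
  let e : (Plus.homologyFunctor _ n).obj ((Plus.singleFunctor _ n).obj M) ≅ M :=
    (DerivedCategory.singleFunctorCompHomologyFunctorIso _ n).app M
  constructor
  · intro h
    exact (h n).of_mono e.inv
  · intro h m
    obtain hm | rfl | hm := lt_trichotomy m n
    · exact ModuleCat.isTors_of_isZero (Plus.isZero_homology_of_isGE _ n m hm)
    · exact h.of_mono e.hom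
    · exact ModuleCat.isTors_of_isZero (Plus.isZero_homology_of_isLE _ n m hm)

/-- The single complex as a bounded below complex. -/
noncomputable abbrev CochainComplex.Plus.single {C : Type*} [Category* C] [Abelian C] (n : ℤ)
    (M : C) : CochainComplex.Plus C where
  obj := (HomologicalComplex.single C (.up ℤ) n).obj M
  property := ⟨n, inferInstance⟩

/-- The single complex of a module as an object of the bounded below derived category. -/
noncomputable def DerivedCategory.Plus.singleFunctorObjIso {C : Type*} [Category* C] [Abelian C]
    [HasDerivedCategory C] (n : ℤ) (M : C) :
    Plus.Q.obj (CochainComplex.Plus.single n M) ≅ (Plus.singleFunctor C n).obj M :=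
  Plus.ι.preimageIso ((quotientCompQhIso C).app _ ≪≫ (singleFunctorIsoCompQ C n).symm.app M)

omit [IsNoetherianRing R] in
lemma isZero_derivedSection_obj {E : ModuleCat.{u} R} [Injective E]
    (hE : (sectionFunctor W).obj E = ⊥) :
    IsZero ((derivedSection W).obj ((Plus.singleFunctor _ 0).obj E)) := by
  let K : CochainComplex.Plus (ModuleCat.{u} R) := .single 0 E
  have hK (n : ℤ) : Injective (K.obj.X n) :=
    inferInstanceAs (Injective (((HomologicalComplex.single _ (.up ℤ) 0).obj E).X n))
  have e := asIso ((sectionFunctor W).toFunctor.rightDerivedFunctorPlusUnit.app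
    ((HomotopyCategory.Plus.quotient _).obj K)) ≪≫
      (derivedSection W).mapIso (Plus.singleFunctorObjIso 0 E)
  refine IsZero.of_iso ?_ e.symm
  refine Plus.isZero_of_homology fun n ↦ ?_
  have h : IsZero (((sectionFunctor W).toFunctor.mapCochainComplexPlus.obj K).obj.homology n) := by
    refine ShortComplex.isZero_homology_of_isZero_X₂ _ ?_
    by_cases hn : n = 0
    · subst hn
      refine IsZero.of_iso (Y := (sectionFunctor W).toFunctor.obj E) ?_
        ((sectionFunctor W).toFunctor.mapIso (HomologicalComplex.singleObjXSelf (.up ℤ) 0 E))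
      have : Subsingleton ((sectionFunctor W).obj E) := by rw [hE]; infer_instance
      exact ModuleCat.isZero_of_subsingleton (ModuleCat.of R ((sectionFunctor W).obj E))
    · exact Functor.map_isZero (sectionFunctor W).toFunctor
        (HomologicalComplex.isZero_single_obj_X (.up ℤ) 0 E n hn)
  exact h.of_iso (Plus.homologyQIso ((sectionFunctor W).toFunctor.mapCochainComplexPlus.obj K) n)

lemma isAbstractLocalCohomology_derivedSection :
    IsAbstractLocalCohomology (derivedSection W) where
  isTriangleFunctor := exists_isTriangulated_derivedSection W
  exists_rightAdjoint := by
    rw [essImage_derivedSection]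
    exact ⟨torsionCoreflector W, ⟨torsionAdjunction W⟩, ⟨(torsionCoreflectorCompιIso W).symm⟩⟩
  divides E hE hE' := by
    rw [essImage_derivedSection, torsionObjects_singleFunctor_iff]
    refine (sectionFunctor_obj_eq_bot_or_top W E hE').symm.imp (fun h x ↦ ?_) (fun h ↦ ?_)
    · rw [← mem_sectionFunctor_iff, h]
      trivial
    · exact isZero_derivedSection_obj W h

variable {W} in
/-- A functor which is the coreflection to the objects with `W`-torsion homology is isomorphic to
the right derived functor of the section functor. -/
lemma nonempty_iso_derivedSection {δ : Plus (ModuleCat.{u} R) ⥤ Plus (ModuleCat.{u} R)}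
    (hδ : IsAbstractLocalCohomology δ) (h : δ.essImage = torsionObjects W) :
    Nonempty (δ ≅ derivedSection W) := by
  obtain ⟨ρ, ⟨adj⟩, ⟨e⟩⟩ := hδ.exists_rightAdjoint
  -- After rewriting the essential image, both functors come from right adjoints of one and the same
  -- inclusion.
  revert ρ
  rw [h]
  intro ρ adj e
  exact ⟨e ≪≫ Functor.isoWhiskerRight (adj.rightAdjointUniq (torsionAdjunction W)) _ ≪≫
    torsionCoreflectorCompιIso W⟩

end Torsion

/-! ### Morphisms to and from modules placed in one degree. -/

section SingleFunctor

open DerivedCategory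

variable {R : Type u} [CommRing R] [HasDerivedCategory.{w} (ModuleCat.{u} R)]

lemma DerivedCategory.Plus.homologyQIso_naturality {K L : CochainComplex.Plus (ModuleCat.{u} R)}
    (f : K ⟶ L) (n : ℤ) :
    (Plus.homologyFunctor _ n).map (Plus.Q.map f) ≫ (Plus.homologyQIso L n).hom =
      (Plus.homologyQIso K n).hom ≫ HomologicalComplex.homologyMap f.hom n := by
  have h := ((Functor.isoWhiskerRight (quotientCompQhIso (ModuleCat.{u} R))
    (DerivedCategory.homologyFunctor _ n)).hom ≫
      (homologyFunctorFactors (ModuleCat.{u} R) n).hom).naturality f.hom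
  exact h

/-- A morphism from the homology to an injective module comes from the derived category. -/
lemma DerivedCategory.Plus.exists_hom_singleFunctor (X : Plus (ModuleCat.{u} R)) (n : ℤ)
    (I : ModuleCat.{u} R) [Injective I] (φ : (Plus.homologyFunctor _ n).obj X ⟶ I) :
    ∃ (f : X ⟶ (Plus.singleFunctor _ n).obj I)
      (e : (Plus.homologyFunctor _ n).obj ((Plus.singleFunctor _ n).obj I) ≅ I),
      (Plus.homologyFunctor _ n).map f ≫ e.hom = φ := by
  obtain ⟨K, -, ⟨e⟩⟩ := X.exists_injective_complex
  let ψ : K.obj.homology n ⟶ I :=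
    (Plus.homologyQIso K n).inv ≫ (Plus.homologyFunctor _ n).map e.hom ≫ φ
  -- A map out of the opcycles is the same as a chain map to the single complex, and homology embeds
  -- in the opcycles.
  let ψ' : K.obj.opcycles n ⟶ I := Injective.factorThru ψ (K.obj.homologyι n)
  let S : CochainComplex.Plus (ModuleCat.{u} R) := .single n I
  let g : K ⟶ S := ObjectProperty.homMk
    (HomologicalComplex.mkHomToSingle (K.obj.pOpcycles n ≫ ψ') fun i _ ↦ by simp)
  let e' : S.obj.homology n ≅ I := HomologicalComplex.singleObjHomologySelfIso (.up ℤ) n I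
  have hg : HomologicalComplex.homologyMap g.hom n ≫ e'.hom = ψ := by
    have h₁ : HomologicalComplex.opcyclesMap g.hom n ≫
        (HomologicalComplex.singleObjOpcyclesSelfIso (.up ℤ) n I).inv = ψ' := by
      rw [← cancel_epi (K.obj.pOpcycles n), HomologicalComplex.p_opcyclesMap_assoc,
        HomologicalComplex.pOpcycles_singleObjOpcyclesSelfIso_inv]
      simp [g]
    rw [← HomologicalComplex.homologyι_singleObjOpcyclesSelfIso_inv,
      HomologicalComplex.homologyι_naturality_assoc, h₁, Injective.comp_factorThru]
  refine ⟨e.inv ≫ Plus.Q.map g ≫ (Plus.singleFunctorObjIso n I).hom,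
    (Plus.homologyFunctor _ n).mapIso (Plus.singleFunctorObjIso n I).symm ≪≫
      Plus.homologyQIso S n ≪≫ e', ?_⟩
  have h := Plus.homologyQIso_naturality g n
  simp only [Functor.map_comp, Iso.trans_hom, Functor.mapIso_hom, Iso.symm_hom, Category.assoc]
  rw [Iso.map_hom_inv_id_assoc, reassoc_of% h, hg]
  simp only [ψ, Iso.hom_inv_id_assoc]
  rw [Iso.map_inv_hom_id_assoc]

/-- A bounded below complex of injectives is K-injective, so derived morphisms into it are homotopy
classes of chain maps. -/
lemma DerivedCategory.Plus.Q_map_bijective (K L : CochainComplex.Plus (ModuleCat.{u} R))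
    [∀ n, Injective (L.obj.X n)] :
    Function.Surjective (Plus.Q.map (X := K) (Y := L)) ∧
      ∀ f : K ⟶ L, Plus.Q.map f = 0 → Nonempty (Homotopy f.hom 0) := by
  obtain ⟨a, _⟩ := L.2
  have hL := CochainComplex.isKInjective_of_injective L.obj a
  have h := Plus.Qh_map_bijective_of_isKInjective ((HomotopyCategory.Plus.quotient _).obj K)
    ((HomotopyCategory.Plus.quotient _).obj L) hL
  refine ⟨h.2.comp (HomotopyCategory.Plus.quotient _).map_surjective, fun f hf ↦ ?_⟩
  rw [← HomotopyCategory.quotient_map_eq_zero_iff]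
  exact congr_arg (HomotopyCategory.Plus.ι _).map
    (h.1 (hf.trans (Functor.map_zero Plus.Qh _ _).symm))

/-- Homotopies from a complex with a single nonzero object. -/
lemma HomologicalComplex.nonempty_homotopy_single_iff {C : Type*} [Category* C] [Abelian C]
    {I : C} {n m : ℤ} (hm : m + 1 = n) {K : CochainComplex C ℤ}
    (f : (HomologicalComplex.single C (.up ℤ) n).obj I ⟶ K) :
    Nonempty (Homotopy f 0) ↔
      ∃ h : I ⟶ K.X m, h ≫ K.d m n =
        (HomologicalComplex.singleObjXSelf (.up ℤ) n I).inv ≫ f.f n := by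
  constructor
  · rintro ⟨H⟩
    refine ⟨(HomologicalComplex.singleObjXSelf (.up ℤ) n I).inv ≫ H.hom n m, ?_⟩
    rw [H.comm n, prevD_eq H.hom (show (ComplexShape.up ℤ).Rel m n from hm),
      dNext_eq H.hom (show (ComplexShape.up ℤ).Rel n (n + 1) from rfl)]
    simp
  · rintro ⟨h, hh⟩
    let k (i j : ℤ) (_ : (ComplexShape.up ℤ).Rel j i) :
        ((HomologicalComplex.single C (.up ℤ) n).obj I).X i ⟶ K.X j :=
      if hi : i = n ∧ j = m then
        (HomologicalComplex.singleObjXIsoOfEq (.up ℤ) n I i hi.1).hom ≫ h ≫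
          (K.XIsoOfEq hi.2.symm).hom
      else 0
    have hf : f = Homotopy.nullHomotopicMap' k := by
      apply HomologicalComplex.from_single_hom_ext
      rw [Homotopy.nullHomotopicMap'_f (show (ComplexShape.up ℤ).Rel m n from hm)
        (show (ComplexShape.up ℤ).Rel n (n + 1) from rfl)]
      rw [← cancel_epi (HomologicalComplex.singleObjXSelf (.up ℤ) n I).inv, ← hh]
      simp [k, HomologicalComplex.singleObjXSelf]
    rw [hf]
    exact ⟨Homotopy.nullHomotopy' k⟩

lemma DerivedCategory.Plus.singleFunctorObjIso_naturality {C : Type*} [Category* C] [Abelian C]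
    [HasDerivedCategory C] (n : ℤ) {M N : C} (f : M ⟶ N) :
    Plus.Q.map (X := .single n M) (Y := .single n N) (ObjectProperty.homMk
      ((HomologicalComplex.single C (.up ℤ) n).map f)) ≫ (Plus.singleFunctorObjIso n N).hom =
      (Plus.singleFunctorObjIso n M).hom ≫ (Plus.singleFunctor C n).map f := by
  apply Plus.ι.map_injective
  have h := ((Functor.isoWhiskerLeft (HomologicalComplex.single C (.up ℤ) n)
    (quotientCompQhIso C)).hom ≫ (singleFunctorIsoCompQ C n).inv).naturality f
  rw [Functor.map_comp, Functor.map_comp]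
  simp only [Plus.singleFunctorObjIso, Functor.preimageIso_hom, Functor.map_preimage]
  exact h

/-- If a morphism from an injective module in degree zero vanishes on all its indecomposable
injective submodules, it vanishes. -/
lemma DerivedCategory.Plus.hom_singleFunctor_eq_zero [IsNoetherianRing R] {I : ModuleCat.{u} R}
    [Injective I] {X : Plus (ModuleCat.{u} R)} (f : (Plus.singleFunctor _ 0).obj I ⟶ X)
    (hf : ∀ L : Submodule R I, Module.Baer R L → Indecomposable (ModuleCat.of R L) →
      (Plus.singleFunctor _ 0).map (ModuleCat.ofHom L.subtype) ≫ f = 0) :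
    f = 0 := by
  obtain ⟨K, hK, ⟨e⟩⟩ := X.exists_injective_complex
  let S (M : ModuleCat.{u} R) : CochainComplex.Plus (ModuleCat.{u} R) := .single 0 M
  obtain ⟨g, hg⟩ := (Plus.Q_map_bijective (S I) K).1
    ((Plus.singleFunctorObjIso 0 I).hom ≫ f ≫ e.inv)
  have hf' : f = (Plus.singleFunctorObjIso 0 I).inv ≫ Plus.Q.map g ≫ e.hom := by
    simp [hg]
  let φ : I ⟶ K.obj.X 0 := (HomologicalComplex.singleObjXSelf (.up ℤ) 0 I).inv ≫ g.hom.f 0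
  -- The chain map g is null-homotopic exactly when φ lifts through K⁻¹ → K⁰, and the hypothesis on
  -- f provides such lifts on each L.
  obtain ⟨h, hh⟩ := ((ModuleCat.injective_iff_baer I).1 inferInstance).exists_comp_eq
    (K.obj.d (-1) 0).hom φ.hom fun L hL hL' ↦ by
      let s : S (ModuleCat.of R L) ⟶ S I :=
        ObjectProperty.homMk ((HomologicalComplex.single _ _ _).map (ModuleCat.ofHom L.subtype))
      have nat : Plus.Q.map s ≫ _ = _ ≫ _ :=
        Plus.singleFunctorObjIso_naturality 0 (ModuleCat.ofHom L.subtype)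
      have h₀ : Plus.Q.map (s ≫ g) = 0 := by
        rw [Functor.map_comp, hg, reassoc_of% nat, reassoc_of% (hf L hL hL')]
        simp
      obtain ⟨h, hh⟩ := (HomologicalComplex.nonempty_homotopy_single_iff
        (show (-1 : ℤ) + 1 = 0 from rfl) _).1 ((Plus.Q_map_bijective _ K).2 _ h₀)
      refine ⟨h.hom, ?_⟩
      rw [← ModuleCat.hom_comp, hh]
      have : (HomologicalComplex.singleObjXSelf (.up ℤ) 0 (ModuleCat.of R L)).inv ≫
        (s ≫ g).hom.f 0 = ModuleCat.ofHom L.subtype ≫ φ := by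
          simp [s, φ, HomologicalComplex.single_map_f_self]
      rw [this]
      rfl
  obtain ⟨H⟩ := (HomologicalComplex.nonempty_homotopy_single_iff
    (show (-1 : ℤ) + 1 = 0 from rfl) g.hom).2
    ⟨ModuleCat.ofHom h, by ext x; exact LinearMap.congr_fun hh x⟩
  have hg0 : Plus.Q.map g = 0 := by
    have : (HomotopyCategory.Plus.quotient _).map g = 0 :=
      (HomotopyCategory.Plus.ι _).map_injective
        ((HomotopyCategory.eq_of_homotopy _ _ H).trans (Functor.map_zero _ _ _))
    exact (congr_arg Plus.Qh.map this).trans (Functor.map_zero _ _ _)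
  rw [hf', hg0, zero_comp, comp_zero]

end SingleFunctor

/-! ### Uniformly bounded below families as retracts of one object. -/

section Product

open DerivedCategory

variable {R : Type u} [CommRing R] [HasDerivedCategory.{w} (ModuleCat.{u} R)]

omit [HasDerivedCategory.{w} (ModuleCat.{u} R)] in
lemma CochainComplex.isStrictlyGE_piObj {ι : Type} (K : ι → CochainComplex (ModuleCat.{u} R) ℤ)
    (a : ℤ) [∀ i, (K i).IsStrictlyGE a] : (∏ᶜ K).IsStrictlyGE a := by
  rw [CochainComplex.isStrictlyGE_iff]
  intro n hn
  refine IsZero.of_iso ?_ (PreservesProduct.iso (HomologicalComplex.eval _ (.up ℤ) n) K)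
  rw [IsZero.iff_id_eq_zero]
  exact Pi.hom_ext _ _ fun i ↦ ((K i).isZero_of_isStrictlyGE a n hn).eq_of_tgt _ _

/-- A uniformly bounded below family in the derived category consists of retracts of a single
object. -/
lemma DerivedCategory.Plus.exists_retract {ι : Type} (X : ι → Plus (ModuleCat.{u} R)) (a : ℤ)
    [∀ i, (X i).IsGE a] : ∃ P : Plus (ModuleCat.{u} R), ∀ i, Nonempty (Retract (X i) P) := by
  classical
  choose K hK e using fun i ↦ DerivedCategory.exists_iso_Q_obj_of_isGE (Plus.ι.obj (X i)) a
  have := CochainComplex.isStrictlyGE_piObj K a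
  refine ⟨⟨DerivedCategory.Q.obj (∏ᶜ K), a, _, Iso.refl _, this⟩, fun i ↦ ?_⟩
  obtain ⟨e⟩ := e i
  exact ⟨{
    i := Plus.ι.preimage (e.hom ≫ DerivedCategory.Q.map (Pi.ι K i))
    r := Plus.ι.preimage (DerivedCategory.Q.map (Pi.π K i) ≫ e.inv)
    retract := Plus.ι.map_injective (by
      rw [Functor.map_comp, Functor.map_preimage, Functor.map_preimage, Category.assoc,
        ← Functor.map_comp_assoc, Pi.ι_π_eq_id]
      simp) }⟩

end Product

/-! ### Orthogonality of the image and the kernel of δ. -/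

section AbstractLocalCohomology

open DerivedCategory Pretriangulated

variable {R : Type u} [CommRing R] [HasDerivedCategory.{w} (ModuleCat.{u} R)]
  {δ : Plus (ModuleCat.{u} R) ⥤ Plus (ModuleCat.{u} R)} (hδ : IsAbstractLocalCohomology δ)

namespace IsAbstractLocalCohomology

include hδ

lemma hom_eq_zero {X Y : Plus (ModuleCat.{u} R)} (hX : δ.essImage X) (hY : δ.kernel Y)
    (f : X ⟶ Y) : f = 0 := by
  obtain ⟨ρ, ⟨adj⟩, ⟨e⟩⟩ := hδ.exists_rightAdjoint
  obtain ⟨g, rfl⟩ := (adj.homEquiv ⟨X, hX⟩ Y).symm.surjective f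
  have hρ : IsZero (δ.essImage.ι.obj (ρ.obj Y)) := IsZero.of_iso hY (e.symm.app Y)
  rw [Adjunction.homEquiv_counit, hρ.eq_of_tgt (δ.essImage.ι.map g) 0, zero_comp]

lemma isStableUnderShift_kernel : δ.kernel.IsStableUnderShift ℤ := by
  obtain ⟨_, _⟩ := hδ.isTriangleFunctor
  exact ⟨fun n ↦ ⟨fun X hX ↦ IsZero.of_iso ((shiftFunctor _ n).map_isZero hX)
    ((δ.commShiftIso n).app X)⟩⟩

lemma isStableUnderShift_essImage : δ.essImage.IsStableUnderShift ℤ := by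
  obtain ⟨_, _⟩ := hδ.isTriangleFunctor
  exact ⟨fun n ↦ ⟨fun X ⟨Y, ⟨e⟩⟩ ↦
    ⟨Y⟦n⟧, ⟨(δ.commShiftIso n).app Y ≪≫ (shiftFunctor _ n).mapIso e⟩⟩⟩⟩

/-- The triangle is completed from the counit of the coreflection. By a triangle identity δ inverts
the counit, so it kills the cone. -/
lemma exists_distinguished (X : Plus (ModuleCat.{u} R)) :
    ∃ (A C : Plus (ModuleCat.{u} R)) (f : A ⟶ X) (g : X ⟶ C) (h : C ⟶ A⟦(1 : ℤ)⟧),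
      Triangle.mk f g h ∈ distTriang _ ∧ δ.essImage A ∧ δ.kernel C := by
  obtain ⟨ρ, ⟨adj⟩, ⟨e⟩⟩ := hδ.exists_rightAdjoint
  obtain ⟨_, _⟩ := hδ.isTriangleFunctor
  obtain ⟨C, g, h, hT⟩ := distinguished_cocone_triangle (adj.counit.app X)
  refine ⟨_, C, _, g, h, hT, (ρ.obj X).property, ?_⟩
  have h₁ : IsIso (ρ.map (adj.counit.app X)) :=
    IsIso.of_isIso_fac_left (adj.right_triangle_components X)
  have h₂ : IsIso (δ.map (adj.counit.app X)) := by
    rw [NatIso.isIso_map_iff e]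
    exact inferInstanceAs (IsIso (δ.essImage.ι.map (ρ.map (adj.counit.app X))))
  exact (Triangle.isZero₃_iff_isIso₁ _ (δ.map_distinguished _ hT)).2 h₂

/-- If X is left orthogonal to the kernel, then X → C vanishes and the identity of C factors through
A[1]. There are no nonzero maps A[1] → C, so C = 0 and A ≅ X. -/
lemma essImage_eq : δ.essImage = δ.kernel.leftOrthogonal := by
  refine le_antisymm (fun X hX Y f hY ↦ hδ.hom_eq_zero hX hY f) fun X hX ↦ ?_
  obtain ⟨A, C, f, g, h, hT, hA, hC⟩ := hδ.exists_distinguished X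
  have := hδ.isStableUnderShift_essImage
  have hg : g = 0 := hX g hC
  obtain ⟨r : A⟦(1 : ℤ)⟧ ⟶ C, hr : 𝟙 C = h ≫ r⟩ := Triangle.yoneda_exact₃ _ hT (𝟙 C) (by
    change g ≫ 𝟙 C = 0
    rw [hg, zero_comp])
  have hC0 : IsZero C := by
    rw [IsZero.iff_id_eq_zero, hr, hδ.hom_eq_zero (δ.essImage.le_shift (1 : ℤ) _ hA) hC r,
      comp_zero]
  have : IsIso f := (Triangle.isZero₃_iff_isIso₁ _ hT).1 hC0
  exact δ.essImage.prop_of_iso (asIso f) hA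

lemma isTriangulated_essImage : δ.essImage.IsTriangulated := by
  have := hδ.isStableUnderShift_kernel
  rw [hδ.essImage_eq]
  infer_instance

end IsAbstractLocalCohomology

end AbstractLocalCohomology

/-! ### Identification of the essential image of δ. -/

section EssImage

open DerivedCategory Pretriangulated

variable {R : Type u} [CommRing R] [HasDerivedCategory.{w} (ModuleCat.{u} R)]

/-- The single functor in any degree is a shift of the one in degree zero. -/
noncomputable def DerivedCategory.Plus.singleFunctorShiftIso (n : ℤ) (M : ModuleCat.{u} R) :
    ((Plus.singleFunctor _ 0).obj M)⟦-n⟧ ≅ (Plus.singleFunctor _ n).obj M :=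
  ((Plus.singleFunctors _).shiftIso (-n) n 0 (by simp)).app M

lemma DerivedCategory.Plus.isGE_of_homology {X : Plus (ModuleCat.{u} R)} {n : ℤ}
    (h : ∀ i < n, IsZero ((Plus.homologyFunctor _ i).obj X)) : X.IsGE n := by
  rw [← isGE_ι_obj_iff, DerivedCategory.isGE_iff]
  exact h

/-- The primes `p` for which an indecomposable injective module containing `R ⧸ p` is in the
essential image of `δ`. -/
def essImagePrimes (δ : Plus (ModuleCat.{u} R) ⥤ Plus (ModuleCat.{u} R)) :
    Set (PrimeSpectrum R) :=
  {p | ∃ E : ModuleCat.{u} R, Injective E ∧ Indecomposable E ∧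
    (∃ f : (R ⧸ p.asIdeal) →ₗ[R] E, Function.Injective f) ∧
    δ.essImage ((Plus.singleFunctor _ 0).obj E)}

variable [IsNoetherianRing R]

/-- An object with torsion homology is, up to an injective module, an object with torsion
homology in higher degrees. -/
lemma exists_distinguished_of_torsionObjects {W : Set (PrimeSpectrum R)}
    {X : Plus (ModuleCat.{u} R)} (hX : torsionObjects W X) (n : ℤ) [X.IsGE n] :
    ∃ (I : ModuleCat.{u} R) (_ : Injective I) (_ : ModuleCat.IsTors W I)
      (X' : Plus (ModuleCat.{u} R)) (_ : torsionObjects W X') (_ : X'.IsGE (n + 1))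
      (f : X' ⟶ X) (g : X ⟶ (Plus.singleFunctor _ n).obj I) (h : _),
      Triangle.mk f g h ∈ distTriang _ := by
  let H := (Plus.homologyFunctor _ n).obj X
  obtain ⟨⟨J, hJ, j, hj⟩⟩ := (ModuleCat.enoughInjectives.{u} R).presentation H
  let I := (sectionFunctor W).toFunctor.obj J
  have hI : Injective I := sectionFunctor_injective W J
  have hIW : ModuleCat.IsTors W I := fun x ↦ .of_map _ (Submodule.subtype_injective _)
      ((mem_sectionFunctor_iff _).1 x.2)
  let φ : H ⟶ I := ModuleCat.ofHom (LinearMap.codRestrict _ j.hom fun x ↦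
    (mem_sectionFunctor_iff _).2 ((hX n x).map j.hom))
  have hφ : Mono φ := by
    rw [ModuleCat.mono_iff_injective] at hj ⊢
    exact fun x y h ↦ hj (congr_arg Subtype.val h)
  obtain ⟨g, e, he⟩ := X.exists_hom_singleFunctor n I φ
  obtain ⟨X', f, h, hT⟩ := distinguished_cocone_triangle₁ g
  -- For i ≤ n the map Hⁱ(f) is injective because Hⁱ⁻¹ of the third vertex vanishes. It is also
  -- zero: for i = n because Hⁿ(g) is injective, below n because Hⁱ(X) = 0.
  refine ⟨I, hI, hIW, X', (torsionObjects W).ext_of_isTriangulatedClosed₁ _ hT hX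
    ((torsionObjects_singleFunctor_iff W n I).2 hIW), ?_, f, g, h, hT⟩
  have hg : Mono ((Plus.homologyFunctor _ n).map g) := by
    have : Mono ((Plus.homologyFunctor _ n).map g ≫ e.hom) := by rw [he]; exact hφ
    exact mono_of_mono _ e.hom
  refine Plus.isGE_of_homology fun i hi ↦ ?_
  have hmono : Mono ((Plus.homologyFunctor _ i).map f) :=
    ((Plus.homologyFunctor _ 0).homologySequence_exact₁ _ hT (i - 1) i (by lia)).mono_g
      ((Plus.isZero_homology_of_isGE ((Plus.singleFunctor _ n).obj I) n (i - 1)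
        (by lia)).eq_of_src _ _)
  have hzero : (Plus.homologyFunctor _ i).map f = 0 := by
    obtain hi | rfl := (Int.lt_add_one_iff.1 hi).lt_or_eq
    · exact (Plus.isZero_homology_of_isGE X n i hi).eq_of_tgt _ _
    · rw [← cancel_mono ((Plus.homologyFunctor _ i).map g), zero_comp]
      rw [← Functor.map_comp, show f ≫ g = 0 from comp_distTriang_mor_zero₁₂ _ hT,
        Functor.map_zero]
  exact IsZero.of_mono_eq_zero _ hzero

variable {δ : Plus (ModuleCat.{u} R) ⥤ Plus (ModuleCat.{u} R)} (hδ : IsAbstractLocalCohomology δ)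

namespace IsAbstractLocalCohomology

include hδ

/-- If z in Hⁿ(X) survives at some q outside `essImagePrimes δ`, then Rz → R/q → E extends to Hⁿ(X)
→ E and yields a nonzero map from X to a shift of E. But E lies in the kernel, a contradiction with
orthogonality. -/
lemma essImage_le : δ.essImage ≤ torsionObjects (essImagePrimes δ) := by
  intro X hX n z q hq
  by_contra! hz
  obtain ⟨E, hE, hE', f, hf⟩ := exists_indecomposable_injective q
  have hker : δ.kernel ((Plus.singleFunctor _ n).obj E) := by
    have := hδ.isStableUnderShift_kernel
    exact δ.kernel.prop_of_iso (Plus.singleFunctorShiftIso n E) (δ.kernel.le_shift (-n) _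
      ((hδ.divides E hE hE').resolve_left fun h ↦ hq ⟨E, hE, hE', ⟨f, hf⟩, h⟩))
  let H := (Plus.homologyFunctor _ n).obj X
  let K := LinearMap.ker (LinearMap.toSpanSingleton R H z)
  let i : (R ⧸ K) →ₗ[R] H := K.liftQ (LinearMap.toSpanSingleton R H z) le_rfl
  have hi : Function.Injective i :=
    LinearMap.ker_eq_bot.1 (Submodule.ker_liftQ_eq_bot _ _ _ le_rfl)
  let k : (R ⧸ K) →ₗ[R] E := K.liftQ (f ∘ₗ Submodule.mkQ q.asIdeal) fun a ha ↦ by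
    have ha : a ∈ q.asIdeal := by
      by_contra h
      exact hz a h ha
    rw [LinearMap.mem_ker, LinearMap.comp_apply, Submodule.mkQ_apply,
      (Submodule.Quotient.mk_eq_zero _).2 ha, map_zero]
  obtain ⟨g, hg⟩ := ((ModuleCat.injective_iff_baer E).1 hE).extension_property i hi k
  obtain ⟨F, e, he⟩ := X.exists_hom_singleFunctor n E (ModuleCat.ofHom g)
  rw [hδ.hom_eq_zero hX hker F, Functor.map_zero, zero_comp] at he
  have h₁ : g z = 0 := congr_arg (fun t ↦ t.hom z) he.symm
  have h₂ : g (i (Submodule.Quotient.mk 1)) = k (Submodule.Quotient.mk 1) :=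
    LinearMap.congr_fun hg _
  have h₃ : i (Submodule.Quotient.mk 1) = z := one_smul R z
  rw [h₃, h₁] at h₂
  have h₄ : f (Submodule.Quotient.mk 1) = 0 := h₂.symm
  exact q.2.one_notMem ((Submodule.Quotient.mk_eq_zero _).1 (hf (h₄.trans (map_zero f).symm)))

lemma isUpperSet_essImagePrimes : IsUpperSet (essImagePrimes δ) := by
  rintro p q hpq ⟨E, hE, hE', ⟨f, hf⟩, h⟩
  by_contra hq
  obtain ⟨r, hr, h⟩ := IsTors.of_map f hf
    ((torsionObjects_singleFunctor_iff _ 0 E).1 (hδ.essImage_le _ h)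
      (f (Submodule.Quotient.mk 1))) q hq
  rw [← Submodule.Quotient.mk_smul, Submodule.Quotient.mk_eq_zero, smul_eq_mul, mul_one] at h
  exact hr (hpq h)

/-- E shares some R/p with an injective E' in the essential image. Were E in the kernel, extending
R/p → E along R/p → E' would give a nonzero map from image to kernel. -/
lemma essImage_of_indecomposable (E : ModuleCat.{u} R) [Injective E] (hE : Indecomposable E)
    (h : ModuleCat.IsTors (essImagePrimes δ) E) :
    δ.essImage ((Plus.singleFunctor _ 0).obj E) := by
  have := ((ModuleCat.indecomposable_iff E).1 hE).1
  obtain ⟨p, g, hg⟩ := exists_injective_quotient_prime (R := R) E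
  obtain ⟨E', -, -, ⟨f, hf⟩, hE'⟩ := (isTors_quotient_iff hδ.isUpperSet_essImagePrimes p).1
    fun x ↦ (h (g x)).of_map g hg
  refine (hδ.divides E inferInstance hE).resolve_right fun hker ↦ ?_
  obtain ⟨k, hk⟩ := ((ModuleCat.injective_iff_baer E).1 inferInstance).extension_property f hf g
  have h₀ : (DerivedCategory.singleFunctor _ 0).map (ModuleCat.ofHom k) = 0 :=
    congr_arg Plus.ι.map
      (hδ.hom_eq_zero hE' hker ((Plus.singleFunctor _ 0).map (ModuleCat.ofHom k)))
  have h₁ : ModuleCat.ofHom k = 0 :=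
    (DerivedCategory.singleFunctor _ 0).map_injective (h₀.trans (Functor.map_zero _ _ _).symm)
  have h₂ : g (Submodule.Quotient.mk 1) = 0 := by
    rw [← hk]
    exact congr_arg (fun t ↦ t.hom (f (Submodule.Quotient.mk 1))) h₁
  exact p.2.one_notMem ((Submodule.Quotient.mk_eq_zero _).1 (hg (h₂.trans (map_zero g).symm)))

/-- Being left orthogonal to the kernel can be tested on indecomposable injective submodules, so no
compatibility of δ with infinite direct sums is needed. -/
lemma essImage_of_injective (I : ModuleCat.{u} R) [Injective I]
    (h : ModuleCat.IsTors (essImagePrimes δ) I) (n : ℤ) :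
    δ.essImage ((Plus.singleFunctor _ n).obj I) := by
  have h₀ : δ.essImage ((Plus.singleFunctor _ 0).obj I) := by
    rw [hδ.essImage_eq]
    refine fun Y f hY ↦ Plus.hom_singleFunctor_eq_zero f fun L hL hL' ↦ ?_
    have : Injective (ModuleCat.of R L) := (ModuleCat.injective_iff_baer _).2 hL
    exact hδ.hom_eq_zero (hδ.essImage_of_indecomposable _ hL' fun x ↦
      (h x).of_map _ L.subtype_injective) hY _
  have := hδ.isStableUnderShift_essImage
  exact δ.essImage.prop_of_iso (Plus.singleFunctorShiftIso n I) (δ.essImage.le_shift (-n) _ h₀)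

omit [IsNoetherianRing R] in
lemma nonempty_iso_of_essImage {X : Plus (ModuleCat.{u} R)} (hX : δ.essImage X) :
    Nonempty (δ.obj X ≅ X) := by
  obtain ⟨ρ, ⟨adj⟩, ⟨e⟩⟩ := hδ.exists_rightAdjoint
  have : IsIso (adj.counit.app X) :=
    adj.isIso_counit_app_iff_mem_essImage.2 ⟨⟨X, hX⟩, ⟨Iso.refl _⟩⟩
  exact ⟨e.app X ≪≫ asIso (adj.counit.app X)⟩

/-- The objects with torsion homology in high degrees which approximate an object. -/
lemma exists_trW {C : Plus (ModuleCat.{u} R)} (hC : torsionObjects (essImagePrimes δ) C)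
    (a : ℤ) [C.IsGE a] (k : ℕ) :
    ∃ (X : Plus (ModuleCat.{u} R)) (_ : X.IsGE (a + k)) (f : X ⟶ C), δ.essImage.trW f := by
  have := hδ.isTriangulated_essImage
  suffices ∃ (X : Plus (ModuleCat.{u} R)) (_ : torsionObjects (essImagePrimes δ) X)
      (_ : X.IsGE (a + k)) (f : X ⟶ C), δ.essImage.trW f by
    obtain ⟨X, -, h⟩ := this
    exact ⟨X, h⟩
  induction k with
  | zero => exact ⟨C, hC, by simpa, 𝟙 C, MorphismProperty.id_mem _ _⟩
  | succ k ih =>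
    obtain ⟨X, hX, _, f, hf⟩ := ih
    obtain ⟨I, _, hI, X', hX', hX'', f', g, h, hT⟩ :=
      exists_distinguished_of_torsionObjects hX (a + k)
    refine ⟨X', hX', ?_, f' ≫ f, MorphismProperty.comp_mem _ _ _ ?_ hf⟩
    · rwa [Nat.cast_succ, ← add_assoc]
    · rw [ObjectProperty.trW_iff]
      exact ⟨_, g, h, hT, hδ.essImage_of_injective I hI _⟩

-- The bound must not depend on k. The shifts X_k[k] are retracts of a single P, and δ P is bounded
-- below simply because δ takes values in D⁺.
omit [IsNoetherianRing R] in
lemma isZero_homology_obj (X : ℕ → Plus (ModuleCat.{u} R)) (a : ℤ)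
    (hX : ∀ k, (X k).IsGE (a + k)) :
    ∃ b : ℤ, ∀ (k : ℕ) (i : ℤ), i < b + k →
      IsZero ((Plus.homologyFunctor _ i).obj (δ.obj (X k))) := by
  obtain ⟨_, _⟩ := hδ.isTriangleFunctor
  have (k : ℕ) : ((X k)⟦(k : ℤ)⟧).IsGE a := Plus.TStructure.t.isGE_shift _ (a + k) k a (by lia)
  obtain ⟨P, r⟩ := Plus.exists_retract (fun k : ℕ ↦ (X k)⟦(k : ℤ)⟧) a
  obtain ⟨b, hb⟩ := (δ.obj P).2
  have hb : (δ.obj P).IsGE b := (Plus.isGE_ι_obj_iff _ b).1 hb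
  refine ⟨b, fun k i hi ↦ ?_⟩
  have h : IsZero ((Plus.homologyFunctor _ (i - k)).obj (δ.obj ((X k)⟦(k : ℤ)⟧))) :=
    IsZero.of_mono ((r k).some.map (δ ⋙ Plus.homologyFunctor _ (i - k))).i
      (Plus.isZero_homology_of_isGE _ b _ (by lia))
  refine h.of_iso ?_
  exact (Plus.homologyShiftIso (δ.obj (X k)) k (i - k) i (by lia)).symm ≪≫
    (Plus.homologyFunctor _ (i - k)).mapIso ((δ.commShiftIso (k : ℤ)).app (X k)).symm

lemma isZero_of_kernel {C : Plus (ModuleCat.{u} R)} (hC : torsionObjects (essImagePrimes δ) C)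
    (hC' : δ.kernel C) : IsZero C := by
  obtain ⟨_, _⟩ := hδ.isTriangleFunctor
  have := hδ.isTriangulated_essImage
  obtain ⟨a, ha⟩ := C.2
  have ha : C.IsGE a := (Plus.isGE_ι_obj_iff C a).1 ha
  choose X hX f hf using hδ.exists_trW hC a
  obtain ⟨b, hb⟩ := hδ.isZero_homology_obj X a hX
  refine Plus.isZero_of_homology fun i ↦ ?_
  obtain ⟨k, hk, hk'⟩ : ∃ k : ℕ, i < a + k ∧ i + 1 < b + k :=
    ⟨(i - a).natAbs + (i + 1 - b).natAbs + 1, by lia, by lia⟩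
  obtain ⟨A, g, h, hT, hA⟩ := (δ.essImage.trW_iff' (f k)).1 (hf k)
  -- Since δ C = 0, A ≅ δ A ≅ δ (X k) inherits the bound b + k, and Hⁱ(C) sits between Hⁱ(X k) = 0
  -- and Hⁱ⁺¹(A) = 0.
  have hg : IsIso (δ.map g) := (Triangle.isZero₃_iff_isIso₁ _ (δ.map_distinguished _ hT)).1 hC'
  obtain ⟨e⟩ := hδ.nonempty_iso_of_essImage hA
  have hA' : IsZero ((Plus.homologyFunctor _ (i + 1)).obj A) :=
    (hb k (i + 1) hk').of_iso ((Plus.homologyFunctor _ (i + 1)).mapIso (e.symm ≪≫ asIso (δ.map g)))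
  exact ((Plus.homologyFunctor _ 0).homologySequence_exact₃ _ hT i (i + 1) rfl).isZero_X₂
    ((Plus.isZero_homology_of_isGE (X k) (a + k) i hk).eq_of_src _ _) (hA'.eq_of_tgt _ _)

/-- The essential image of an abstract local cohomology functor consists of the objects with
torsion homology. -/
lemma essImage_eq_torsionObjects : δ.essImage = torsionObjects (essImagePrimes δ) := by
  refine le_antisymm hδ.essImage_le fun X hX ↦ ?_
  obtain ⟨A, C, f, g, h, hT, hA, hC⟩ := hδ.exists_distinguished X
  have hC' : torsionObjects (essImagePrimes δ) C :=
    (torsionObjects _).ext_of_isTriangulatedClosed₃ _ hT (hδ.essImage_le _ hA) hX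
  have : IsIso f := (Triangle.isZero₃_iff_isIso₁ _ hT).1 (hδ.isZero_of_kernel hC' hC)
  exact δ.essImage.prop_of_iso (asIso f) hA

end IsAbstractLocalCohomology

end EssImage

/-! ### The order isomorphisms and transport of completeness. -/

section Lattice

lemma CompleteLattice.isCompleteLatticeOrder (α : Type*) [CompleteLattice α] :
    IsCompleteLatticeOrder α where
  le_refl := _root_.le_refl
  le_trans _ _ _ := _root_.le_trans
  le_antisymm _ _ := _root_.le_antisymm
  exists_isLUB s := ⟨_, isLUB_sSup s⟩
  exists_isGLB s := ⟨_, isGLB_sInf s⟩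

lemma IsCompleteLatticeOrder.of_orderIso {α β : Type*} [LE α] [LE β] (e : α ≃o β)
    (h : IsCompleteLatticeOrder α) : IsCompleteLatticeOrder β where
  le_refl b := by
    rw [← e.symm.le_iff_le]
    exact h.le_refl _
  le_trans a b c hab hbc := by
    rw [← e.symm.le_iff_le] at hab hbc ⊢
    exact h.le_trans _ _ _ hab hbc
  le_antisymm a b hab hba := by
    rw [← e.symm.le_iff_le] at hab hba
    exact e.symm.injective (h.le_antisymm _ _ hab hba)
  exists_isLUB s := by
    obtain ⟨a, ha⟩ := h.exists_isLUB (e ⁻¹' s)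
    refine ⟨e a, fun b hb ↦ ?_, fun b hb ↦ ?_⟩
    · rw [← e.symm.le_iff_le, e.symm_apply_apply]
      exact ha.1 (show e (e.symm b) ∈ s by simpa)
    · rw [← e.symm.le_iff_le, e.symm_apply_apply]
      refine ha.2 fun c hc ↦ ?_
      rw [← e.le_iff_le, e.apply_symm_apply]
      exact hb hc
  exists_isGLB s := by
    obtain ⟨a, ha⟩ := h.exists_isGLB (e ⁻¹' s)
    refine ⟨e a, fun b hb ↦ ?_, fun b hb ↦ ?_⟩
    · rw [← e.symm.le_iff_le, e.symm_apply_apply]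
      exact ha.1 (show e (e.symm b) ∈ s by simpa)
    · rw [← e.symm.le_iff_le, e.symm_apply_apply]
      refine ha.2 fun c hc ↦ ?_
      rw [← e.le_iff_le, e.apply_symm_apply]
      exact hb hc

variable {R : Type u} [CommRing R] [IsNoetherianRing R]

variable (R) in
/-- Specialization-closed subsets correspond to left exact radical functors. -/
def sectionFunctorOrderIso : SpecializationClosed R ≃o LeftExactRadical R where
  toFun W := ⟨sectionFunctor W.1, sectionFunctor_isLeftExact W.1, sectionFunctor_isRadical W.1⟩
  invFun γ := ⟨γ.1.primes, γ.1.isUpperSet_primes⟩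
  left_inv W := Subtype.ext (primes_sectionFunctor W.2)
  right_inv γ := Subtype.ext (PreradicalFunctor.eq_sectionFunctor_primes γ.2.1 γ.2.2).symm
  map_rel_iff' {W W'} := sectionFunctor_le_iff W.2 W'.2

variable [HasDerivedCategory.{w} (ModuleCat.{u} R)]

/-- Isomorphic functors have the same essential image, and R/p in degree 0 belongs to it exactly
when p ∈ W. -/
lemma derivedClass_sectionFunctor_injective {W W' : Set (PrimeSpectrum R)} (hW : IsUpperSet W)
    (hW' : IsUpperSet W') (h : derivedClass (sectionFunctor W) = derivedClass (sectionFunctor W')) :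
    W = W' := by
  obtain ⟨e⟩ := Quotient.exact h
  have h : torsionObjects W = torsionObjects W' := by
    rw [← essImage_derivedSection, ← essImage_derivedSection]
    exact Functor.essImage_eq_of_natIso e
  ext p
  rw [← isTors_quotient_iff hW, ← isTors_quotient_iff hW']
  have := torsionObjects_singleFunctor_iff W 0 (ModuleCat.of R (R ⧸ p.asIdeal))
  rw [h, torsionObjects_singleFunctor_iff] at this
  exact this.symm

variable (R) in
/-- The right derived functor of a left exact radical functor as an abstract local cohomology
functor. -/
noncomputable def derivedClassEquiv : LeftExactRadical R ≃ AbstractLocalCohomologyClass R :=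
  Equiv.ofBijective
    (fun γ ↦ ⟨derivedClass γ.1, _, PreradicalFunctor.eq_sectionFunctor_primes γ.2.1 γ.2.2 ▸
      isAbstractLocalCohomology_derivedSection _, rfl⟩) <| by
    constructor
    · intro γ γ' h
      have h : derivedClass γ.1 = derivedClass γ'.1 := congr_arg Subtype.val h
      rw [PreradicalFunctor.eq_sectionFunctor_primes γ.2.1 γ.2.2,
        PreradicalFunctor.eq_sectionFunctor_primes γ'.2.1 γ'.2.2] at h
      refine (sectionFunctorOrderIso R).symm.injective (Subtype.ext ?_)
      exact derivedClass_sectionFunctor_injective γ.1.isUpperSet_primes γ'.1.isUpperSet_primes h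
    · rintro ⟨c, δ, hδ, rfl⟩
      obtain ⟨e⟩ := nonempty_iso_derivedSection hδ hδ.essImage_eq_torsionObjects
      exact ⟨sectionFunctorOrderIso R ⟨_, hδ.isUpperSet_essImagePrimes⟩,
        Subtype.ext (Quotient.sound ⟨e.symm⟩)⟩

variable (R) in
/-- Left exact radical functors correspond to classes of abstract local cohomology functors. -/
noncomputable def derivedClassOrderIso : LeftExactRadical R ≃o AbstractLocalCohomologyClass R where
  toEquiv := derivedClassEquiv R
  map_rel_iff' {γ γ'} := by
    constructor
    -- Representatives in 𝕊(R) are unique by injectivity, so the existential order compares γ and γ'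
    -- themselves.
    · rintro ⟨γ₁, γ₂, h₁, h₂, h⟩
      rwa [(derivedClassEquiv R).injective (Subtype.ext h₁),
        (derivedClassEquiv R).injective (Subtype.ext h₂)]
    · exact fun h ↦ ⟨γ, γ', rfl, rfl, h⟩

end Lattice

theorem theorem3p3 (R : Type u) [CommRing R] [IsNoetherianRing R]
    [HasDerivedCategory.{w} (ModuleCat.{u} R)] :
    IsCompleteLatticeOrder (SpecializationClosed R) ∧
    IsCompleteLatticeOrder (LeftExactRadical R) ∧
    IsCompleteLatticeOrder (AbstractLocalCohomologyClass R) ∧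
    (∃ e : SpecializationClosed R ≃o LeftExactRadical R,
      ∀ W, (e W).1 = sectionFunctor W.1) ∧
    (∃ e : LeftExactRadical R ≃o AbstractLocalCohomologyClass R,
      ∀ γ, (e γ).1 = derivedClass γ.1) ∧
    (∃ e : SpecializationClosed R ≃o AbstractLocalCohomologyClass R,
      ∀ W, (e W).1 = derivedClass (sectionFunctor W.1)) := by
  have h := CompleteLattice.isCompleteLatticeOrder (SpecializationClosed R)
  let e₁ := sectionFunctorOrderIso R
  let e₂ := derivedClassOrderIso.{w} R
  exact ⟨h, h.of_orderIso e₁, (h.of_orderIso e₁).of_orderIso e₂, ⟨e₁, fun _ ↦ rfl⟩,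
    ⟨e₂, fun _ ↦ rfl⟩, ⟨e₁.trans e₂, fun _ ↦ rfl⟩⟩
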